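/- Let $\Bbbk$ be a field with algebraic closure $\overline{\Bbbk}$. By an operad we mean a symmetric operad $\mathcal P=\{\mathcal P(n)\}_{n\ge 0}$ in $\Bbbk$-vector spaces, with right actions $x\mapsto x\ast\sigma$ of $\mathbb S_n$ on $\mathcal P(n)$ and partial compositions $\circ_i:\mathcal P(m)\otimes\mathcal P(n)\to\mathcal P(m+n-1)$, that is reduced ($\mathcal P(0)=0$) and locally finite ($\dim_{\Bbbk}\mathcal P(n)<\infty$ for all $n$). Write $\dim$ for $\dim_{\Bbbk}$. An operad $\mathcal P$ is called - *prime* if $I\circ J\ne 0$ for all nonzero two-sided ideals $I,J$ of $\mathcal P$, where $I\circ J$ is the $\mathbb S$-submodule generated by all $x\circ_i y$ with $x\in I$, $y\in J$; - *almost $\mathbb A$-trivial* if for all sufficiently large $n$ one has $x\ast\sigma=x$ for all $x\in\mathcal P(n)$ and all $\sigma$ in the alternating group $\mathbb A_n$; - *connected* if $\dim\mathcal P(1)=1$. The GK-dimension of $\mathcal P$ is $\limsup_{n\to\infty}\log_n\bigl(\sum_{i=0}^n\dim\mathcal P(i)\bigr)$, and its Hilbert series is $\sum_{n\ge0}\dim\mathcal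 P(n)\,t^n$. For an extension field $F$ of $\Bbbk$, let $\mathcal Com_F$ be the operad with $\mathcal Com_F(0)=0$ and $\mathcal Com_F(n)=F\mu_n$ for $n\ge1$, with $\mu_n\ast\sigma=\mu_n$ and $\mu_m\circ_i\mu_n=\mu_{m+n-1}$; let $\mathcal Ope_F$ be the operad with $\mathcal Ope_F(n)=0$ for even $n$ and $\mathcal Ope_F(n)=F\mu_n$ for odd $n$, with $\mu_n\ast\sigma=\operatorname{sgn}(\sigma)\mu_n$ and $\mu_m\circ_i\mu_n=\mu_{m+n-1}$ for odd $m,n$. In both cases the compositions are $F$-bilinear, and both are regarded as operads over $\Bbbk$ (not necessarily locally finite). "$\mathcal P$ is a suboperad of $\mathcal Q$" means that there is an injective homomorphism of operads over $\Bbbk$ from $\mathcal P$ to $\mathcal Q$. **Theorem.** Let $\mathcal P$ be a prime almost $\mathbb A$-trivial operad over $\Bbbk$ of GK-dimension $1$ (not necessarily finitely generated). Then: 1. $\mathcal P$ is a suboperad of $\mathcal Com_{\overline{\Bbbk}}$ or of $\mathcal Ope_{\overline{\Bbbk}}$. 2. The following are equivalent: (a) $\mathcal P$ is finitely generated as an operad;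 (b) there is a finite field extension $F$ of $\Bbbk$ such that $\mathcal P$ is a suboperad of $\mathcal Com_F$ or of $\mathcal Ope_F$; (c) there is an integer $d$ such that $\dim\mathcal P(n)\le d$ for all $n$; (d) the Hilbert series of $\mathcal P$ is rational, i.e. a quotient of two polynomials. 3. If $\Bbbk$ is algebraically closed, then $\mathcal P$ is finitely generated and connected. -/

import Mathlib

universe u v w

/-- The input slots of a partial composition `x ∘ᵢ y`, where `x` has arity `m`, `y` has arity `n` and
the result has arity `r = m + n - 1` (all slots are numbered from `0`). The remaining slots
`a ≠ i` of `x` and the slots `b` of `y` are listed in the order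
`0, …, i - 1, (all slots of y), i + 1, …, m - 1`. -/
def operadSlot {m n r : ℕ} (h : r + 1 = m + n) (i : Fin m) :
    {a : Fin m // a ≠ i} ⊕ Fin n → Fin r
  | Sum.inl a =>
      if hlt : (a.1 : ℕ) < i then ⟨a.1, by have := i.2; omega⟩
      else ⟨(a.1 : ℕ) + n - 1, by
        have h1 := a.1.2
        have h2 : (a.1 : ℕ) ≠ i := fun e => a.2 (Fin.ext e)
        omega⟩
  | Sum.inr b => ⟨(i : ℕ) + b, by have h1 := i.2; have h2 := b.2; omega⟩

theorem operadSlot_bijective {m n r : ℕ} (h : r + 1 = m + n) (i : Fin m) :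
    Function.Bijective (operadSlot h i) := by
  constructor
  · rintro (⟨a, ha⟩ | b) (⟨a', ha'⟩ | b') e
    · have h1 : (a : ℕ) ≠ i := fun e => ha (Fin.ext e)
      have h2 : (a' : ℕ) ≠ i := fun e => ha' (Fin.ext e)
      have : (a : ℕ) = a' := by
        simp only [operadSlot] at e
        split_ifs at e <;> simp only [Fin.mk.injEq] at e <;> omega
      congr 2
      exact Fin.ext this
    · exfalso
      have h1 : (a : ℕ) ≠ i := fun e => ha (Fin.ext e)
      have := b'.2
      simp only [operadSlot] at e
      split_ifs at e <;> simp only [Fin.mk.injEq] at e <;> omega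
    · exfalso
      have h1 : (a' : ℕ) ≠ i := fun e => ha' (Fin.ext e)
      have := b.2
      simp only [operadSlot] at e
      split_ifs at e <;> simp only [Fin.mk.injEq] at e <;> omega
    · simp only [operadSlot, Fin.mk.injEq] at e
      congr 1
      exact Fin.ext (by omega)
  · intro s
    have hs := s.2
    have hi := i.2
    by_cases h1 : (s : ℕ) < i
    · refine ⟨Sum.inl ⟨⟨s, by omega⟩, fun e => ?_⟩, ?_⟩
      · have := congrArg Fin.val e
        simp only at this
        omega
      · simp [operadSlot, h1]
    · by_cases h2 : (s : ℕ) < i + n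
      · refine ⟨Sum.inr ⟨(s : ℕ) - i, by omega⟩, ?_⟩
        apply Fin.ext
        simp only [operadSlot]
        omega
      · refine ⟨Sum.inl ⟨⟨(s : ℕ) + 1 - n, by omega⟩, fun e => ?_⟩, ?_⟩
        · have := congrArg Fin.val e
          simp only at this
          omega
        · have h3 : ¬ ((s : ℕ) + 1 - n < i) := by omega
          simp only [operadSlot, h3, dite_false]
          apply Fin.ext
          simp only
          omega

/-- `operadSlot` as a bijection. -/
noncomputable def operadSlotEquiv {m n r : ℕ} (h : r + 1 = m + n) (i : Fin m) :
    {a : Fin m // a ≠ i} ⊕ Fin n ≃ Fin r :=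
  Equiv.ofBijective (operadSlot h i) (operadSlot_bijective h i)

/-- The permutation `σ'`: it permutes the slots of the inner operation of `x ∘ᵢ y` by `σ` and fixes
all the others. -/
noncomputable def innerPerm {m n r : ℕ} (h : r + 1 = m + n) (i : Fin m)
    (σ : Equiv.Perm (Fin n)) : Equiv.Perm (Fin r) :=
  (operadSlotEquiv h i).symm.trans
    ((Equiv.sumCongr (Equiv.refl _) σ).trans (operadSlotEquiv h i))

/-- The permutation `φ''`: it permutes the `m` blocks of slots of a composition by `φ`, where the
block number `i` consists of the `n` slots of the inner operation (whose order is kept) and all the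
other blocks have size one. -/
noncomputable def outerPerm {m n r : ℕ} (h : r + 1 = m + n) (i : Fin m)
    (φ : Equiv.Perm (Fin m)) : Equiv.Perm (Fin r) :=
  (operadSlotEquiv h i).symm.trans
    ((Equiv.sumCongr
      (φ.subtypeEquiv (fun a => by simp) : {a : Fin m // a ≠ i} ≃ {a : Fin m // a ≠ φ i})
      (Equiv.refl (Fin n))).trans (operadSlotEquiv h (φ i)))

/-- A symmetric operad in vector spaces over the field `k` (partial definition). The composition
`comp h i x y` is `x ∘ᵢ y`; its arity `r` is any number equal to `m + n - 1`, with the proof `h`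
of `r + 1 = m + n` as an argument. Slots are numbered from `0`. -/
structure SymmOperad (k : Type u) [Field k] where
  /-- the space of `n`-ary operations -/
  obj : ℕ → Type v
  [addCommGroup : ∀ n, AddCommGroup (obj n)]
  [module : ∀ n, Module k (obj n)]
  /-- the right action: `act σ x` is `x * σ` -/
  act : ∀ {n : ℕ}, Equiv.Perm (Fin n) → obj n →ₗ[k] obj n
  act_one : ∀ {n : ℕ} (x : obj n), act 1 x = x
  act_mul : ∀ {n : ℕ} (σ τ : Equiv.Perm (Fin n)) (x : obj n), act (σ * τ) x = act τ (act σ x)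
  /-- the identity operation -/
  one : obj 1
  /-- partial composition -/
  comp : ∀ {m n r : ℕ}, r + 1 = m + n → Fin m → obj m →ₗ[k] obj n →ₗ[k] obj r
  comp_one : ∀ {n : ℕ} (i : Fin n) (x : obj n), comp rfl i x one = x
  one_comp : ∀ {n : ℕ} (x : obj n), comp (Nat.add_comm n 1) 0 one x = x
  /-- sequential composition: `(x ∘ᵢ y) ∘_{i + j} z = x ∘ᵢ (y ∘ⱼ z)` -/
  comp_assoc : ∀ {l m n p q r : ℕ} (hp : p + 1 = l + m) (hr : r + 1 = p + n)
    (hq : q + 1 = m + n) (hr' : r + 1 = l + q) (i : Fin l) (j : Fin m)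
    (x : obj l) (y : obj m) (z : obj n),
    comp hr ⟨(i : ℕ) + j, by omega⟩ (comp hp i x y) z =
      comp hr' i x (comp hq j y z)
  /-- parallel composition: `(x ∘ᵢ y) ∘_{c + m - 1} z = (x ∘_c z) ∘ᵢ y` for `i < c` -/
  comp_parallel : ∀ {l m n p q r : ℕ} (hp : p + 1 = l + m) (hr : r + 1 = p + n)
    (hq : q + 1 = l + n) (hr' : r + 1 = q + m) (i c : Fin l) (hic : (i : ℕ) < (c : ℕ))
    (x : obj l) (y : obj m) (z : obj n),
    comp hr ⟨(c : ℕ) + m - 1, by omega⟩ (comp hp i x y) z =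
      comp hr' ⟨i, by omega⟩ (comp hq c x z) y
  comp_act : ∀ {m n r : ℕ} (h : r + 1 = m + n) (i : Fin m) (x : obj m)
    (σ : Equiv.Perm (Fin n)) (y : obj n),
    comp h i x (act σ y) = act (innerPerm h i σ) (comp h i x y)
  act_comp : ∀ {m n r : ℕ} (h : r + 1 = m + n) (i : Fin m) (φ : Equiv.Perm (Fin m))
    (x : obj m) (y : obj n),
    comp h i (act φ x) y = act (outerPerm h i φ) (comp h (φ i) x y)

attribute [instance] SymmOperad.addCommGroup SymmOperad.module

namespace SymmOperad

variable {k : Type u} [Field k]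

/-- `P(0) = 0`. -/
def IsReduced (P : SymmOperad.{u, v} k) : Prop := ∀ x : P.obj 0, x = 0

/-- Every `P(n)` is finite dimensional. -/
def IsLocallyFinite (P : SymmOperad.{u, v} k) : Prop := ∀ n, FiniteDimensional k (P.obj n)

/-- `dim P(n)`. -/
noncomputable def dim (P : SymmOperad.{u, v} k) (n : ℕ) : ℕ := Module.finrank k (P.obj n)

/-- The two-sided ideals of an operad. -/
structure OpIdeal (P : SymmOperad.{u, v} k) where
  carrier : ∀ n, Submodule k (P.obj n)
  act_mem : ∀ {n : ℕ} (σ : Equiv.Perm (Fin n)) {x : P.obj n}, x ∈ carrier n →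
    P.act σ x ∈ carrier n
  comp_mem_left : ∀ {m n r : ℕ} (h : r + 1 = m + n) (i : Fin m) {x : P.obj m} (y : P.obj n),
    x ∈ carrier m → P.comp h i x y ∈ carrier r
  comp_mem_right : ∀ {m n r : ℕ} (h : r + 1 = m + n) (i : Fin m) (x : P.obj m) {y : P.obj n},
    y ∈ carrier n → P.comp h i x y ∈ carrier r

/-- The collection `I ∘ J`: the `𝕊`-submodule generated by all `x ∘ᵢ y` with `x` in `I` and `y` in
`J`. -/
def circ (P : SymmOperad.{u, v} k) (I J : ∀ n, Submodule k (P.obj n)) (r : ℕ) :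
    Submodule k (P.obj r) :=
  Submodule.span k {z | ∃ (m n : ℕ) (h : r + 1 = m + n) (i : Fin m) (σ : Equiv.Perm (Fin r)),
    ∃ x ∈ I m, ∃ y ∈ J n, z = P.act σ (P.comp h i x y)}

/-- `P` is prime: `I ∘ J ≠ 0` for all nonzero ideals `I` and `J`. -/
def IsPrime (P : SymmOperad.{u, v} k) : Prop :=
  ∀ I J : OpIdeal P, (∃ n, I.carrier n ≠ ⊥) → (∃ n, J.carrier n ≠ ⊥) →
    ∃ r, P.circ I.carrier J.carrier r ≠ ⊥

/-- `P` is almost `𝔸`-trivial: for all large `n`, the alternating group acts trivially on `P(n)`. -/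
def IsAlmostATrivial (P : SymmOperad.{u, v} k) : Prop :=
  ∃ N : ℕ, ∀ n, N ≤ n → ∀ σ ∈ alternatingGroup (Fin n), ∀ x : P.obj n, P.act σ x = x

/-- The Gelfand-Kirillov dimension of a locally finite operad,
`limsup_{n → ∞} log_n (∑_{i = 0}^n dim P(i))`, in the extended reals. -/
noncomputable def gkDim (P : SymmOperad.{u, v} k) : EReal :=
  Filter.limsup
    (fun n : ℕ => ((Real.logb (n : ℝ) ((∑ i ∈ Finset.range (n + 1), P.dim i : ℕ) : ℝ) : ℝ) : EReal))
    Filter.atTop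

/-- The Hilbert series `∑ dim P(n) t ^ n`. -/
noncomputable def hilbertSeries (P : SymmOperad.{u, v} k) : PowerSeries ℚ :=
  PowerSeries.mk fun n => (P.dim n : ℚ)

/-- The Hilbert series is a quotient of two polynomials. -/
def HasRationalHilbertSeries (P : SymmOperad.{u, v} k) : Prop :=
  ∃ f g : Polynomial ℚ, g ≠ 0 ∧ (g : PowerSeries ℚ) * P.hilbertSeries = (f : PowerSeries ℚ)

/-- The dimensions `dim P(n)` are bounded. -/
def IsUniformlyBounded (P : SymmOperad.{u, v} k) : Prop := ∃ d : ℕ, ∀ n, P.dim n ≤ d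

/-- `dim P(1) = 1`. -/
def IsConnected (P : SymmOperad.{u, v} k) : Prop := P.dim 1 = 1

/-- The suboperads of an operad. -/
structure Suboperad (P : SymmOperad.{u, v} k) where
  carrier : ∀ n, Submodule k (P.obj n)
  one_mem : P.one ∈ carrier 1
  act_mem : ∀ {n : ℕ} (σ : Equiv.Perm (Fin n)) {x : P.obj n}, x ∈ carrier n →
    P.act σ x ∈ carrier n
  comp_mem : ∀ {m n r : ℕ} (h : r + 1 = m + n) (i : Fin m) {x : P.obj m} {y : P.obj n},
    x ∈ carrier m → y ∈ carrier n → P.comp h i x y ∈ carrier r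

/-- `P` is finitely generated: there is a finite set of elements that is contained in no proper
suboperad. -/
def IsFinitelyGenerated (P : SymmOperad.{u, v} k) : Prop :=
  ∃ S : Set (Σ n, P.obj n), S.Finite ∧
    ∀ Q : Suboperad P, (∀ s ∈ S, s.2 ∈ Q.carrier s.1) → ∀ n, Q.carrier n = ⊤

/-- Homomorphisms of operads over `k`. -/
structure Hom (P : SymmOperad.{u, v} k) (Q : SymmOperad.{u, w} k) where
  toFun : ∀ n, P.obj n →ₗ[k] Q.obj n
  map_one : toFun 1 P.one = Q.one
  map_act : ∀ {n : ℕ} (σ : Equiv.Perm (Fin n)) (x : P.obj n),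
    toFun n (P.act σ x) = Q.act σ (toFun n x)
  map_comp : ∀ {m n r : ℕ} (h : r + 1 = m + n) (i : Fin m) (x : P.obj m) (y : P.obj n),
    toFun r (P.comp h i x y) = Q.comp h i (toFun m x) (toFun n y)

/-- `P` is (isomorphic over `k` to) a suboperad of `Q`: there is an injective homomorphism. -/
def IsSuboperadOf (P : SymmOperad.{u, v} k) (Q : SymmOperad.{u, w} k) : Prop :=
  ∃ f : Hom P Q, ∀ n, Function.Injective (f.toFun n)

end SymmOperad

theorem sign_innerPerm {m n r : ℕ} (h : r + 1 = m + n) (i : Fin m) (σ : Equiv.Perm (Fin n)) :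
    Equiv.Perm.sign (innerPerm h i σ) = Equiv.Perm.sign σ := by
  refine (Equiv.Perm.sign_symm_trans_trans
    (Equiv.sumCongr (Equiv.refl {a : Fin m // a ≠ i}) σ) (operadSlotEquiv h i)).trans ?_
  have h2 := Equiv.Perm.sign_sumCongr (1 : Equiv.Perm {a : Fin m // a ≠ i}) σ
  rw [Equiv.Perm.sign_one, one_mul] at h2
  exact h2

theorem outerPerm_slot {m n r : ℕ} (h : r + 1 = m + n) (i : Fin m) (φ : Equiv.Perm (Fin m))
    (s : {a : Fin m // a ≠ i} ⊕ Fin n) :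
    outerPerm h i φ (operadSlot h i s) =
      operadSlot h (φ i) (Sum.map (fun a => ⟨φ a.1, fun e => a.2 (φ.injective e)⟩) id s) := by
  have : operadSlot h i s = operadSlotEquiv h i s := rfl
  rw [this]
  unfold outerPerm
  simp only [Equiv.trans_apply, Equiv.symm_apply_apply]
  rcases s with s | s <;> rfl

theorem outerPerm_ext {m n r : ℕ} (h : r + 1 = m + n) (i : Fin m) (φ : Equiv.Perm (Fin m))
    (ψ : Equiv.Perm (Fin r))
    (H : ∀ s, ψ (operadSlot h i s) =
      operadSlot h (φ i) (Sum.map (fun a => ⟨φ a.1, fun e => a.2 (φ.injective e)⟩) id s)) :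
    outerPerm h i φ = ψ := by
  ext1 t
  obtain ⟨s, rfl⟩ := (operadSlot_bijective h i).2 t
  rw [outerPerm_slot, H]

theorem outerPerm_one {m n r : ℕ} (h : r + 1 = m + n) (i : Fin m) :
    outerPerm h i 1 = 1 :=
  outerPerm_ext h i 1 1 fun s => by rcases s with s | s <;> rfl

theorem outerPerm_mul {m n r : ℕ} (h : r + 1 = m + n) (i : Fin m) (φ ψ : Equiv.Perm (Fin m)) :
    outerPerm h i (φ * ψ) = outerPerm h (ψ i) φ * outerPerm h i ψ :=
  outerPerm_ext h i (φ * ψ) _ fun s => by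
    rw [Equiv.Perm.mul_apply, outerPerm_slot, outerPerm_slot]
    rcases s with s | s <;> rfl

theorem sign_outerPerm_swap {m n r : ℕ} (hn : Odd n) (h : r + 1 = (m + 1) + n) (i : Fin (m + 1))
    (a : Fin m) :
    Equiv.Perm.sign (outerPerm h i (Equiv.swap a.castSucc a.succ)) = -1 := by
  have key : ∀ a : Fin m, Equiv.Perm.sign
      (outerPerm h a.castSucc (Equiv.swap a.castSucc a.succ)) = -1 := by
    intro a
    have ha := a.2
    have hr : NeZero r := ⟨by omega⟩
    have han : (a : ℕ) + n < r := by omega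
    have har : (a : ℕ) < r := by omega
    have e : outerPerm h a.castSucc (Equiv.swap a.castSucc a.succ) =
        Fin.cycleIcc ⟨a, har⟩ ⟨(a : ℕ) + n, han⟩ := by
      refine outerPerm_ext h _ _ _ fun s => ?_
      have hsw : Equiv.swap a.castSucc a.succ a.castSucc = a.succ := Equiv.swap_apply_left _ _
      rcases s with ⟨b, hb⟩ | b
      · have hb' : (b : ℕ) ≠ a := fun e => hb (Fin.ext (by simpa using e))
        rcases lt_or_gt_of_ne hb' with hlt | hgt
        · have h1 : operadSlot h a.castSucc (Sum.inl ⟨b, hb⟩) = ⟨b, by omega⟩ := by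
            simp [operadSlot, hlt]
          have h2 : Equiv.swap a.castSucc a.succ b = b := by
            apply Equiv.swap_apply_of_ne_of_ne hb
            intro e
            have := congrArg Fin.val e
            simp at this
            omega
          rw [h1, Fin.cycleIcc_of_lt (by simpa [Fin.lt_def] using hlt)]
          apply Fin.ext
          have h3 : (b : ℕ) < a + 1 := by omega
          simp [operadSlot, h2, hsw, h3]
        · by_cases hbs : b = a.succ
          · subst hbs
            have h1 : operadSlot h a.castSucc (Sum.inl ⟨a.succ, hb⟩) = ⟨(a : ℕ) + n, han⟩ := by
              apply Fin.ext
              simp [operadSlot]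
            rw [h1, Fin.cycleIcc_of_last (by simp [Fin.le_def])]
            apply Fin.ext
            simp [operadSlot]
          · have h2 : Equiv.swap a.castSucc a.succ b = b :=
              Equiv.swap_apply_of_ne_of_ne hb hbs
            have h4 : (b : ℕ) ≠ a + 1 := fun e => hbs (Fin.ext (by simpa using e))
            have h5 : ¬ (b : ℕ) < a := by omega
            have h6 : ¬ (b : ℕ) < a + 1 := by omega
            have hb2 := b.2
            have h1 : operadSlot h a.castSucc (Sum.inl ⟨b, hb⟩) =
                ⟨(b : ℕ) + n - 1, by omega⟩ := by
              simp [operadSlot, h5]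
            rw [h1, Fin.cycleIcc_of_gt (by simp only [Fin.lt_def]; omega)]
            apply Fin.ext
            simp [operadSlot, h2, hsw, h6]
      · have hb := b.2
        have h1 : operadSlot h a.castSucc (Sum.inr b) = ⟨(a : ℕ) + b, by omega⟩ := by
          simp [operadSlot]
        rw [h1, Fin.cycleIcc_of_ge_of_lt (by simp [Fin.le_def]) (by simp [Fin.lt_def])]
        apply Fin.ext
        rw [Fin.val_add_one_of_lt' (by simp only; omega)]
        simp [operadSlot, hsw]
        omega
    rw [e, Fin.sign_cycleIcc_of_le (by simp [Fin.le_def])]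
    simp [hn.neg_one_pow]
  by_cases h1 : i = a.castSucc
  · rw [h1]
    exact key a
  by_cases h2 : i = a.succ
  · have := outerPerm_mul h i (Equiv.swap a.castSucc a.succ) (Equiv.swap a.castSucc a.succ)
    rw [Equiv.swap_mul_self, outerPerm_one] at this
    have h3 : Equiv.swap a.castSucc a.succ i = a.castSucc := by
      rw [h2, Equiv.swap_apply_right]
    rw [h3] at this
    have h4 := congrArg Equiv.Perm.sign this
    rw [Equiv.Perm.sign_mul, key a, Equiv.Perm.sign_one] at h4
    have h5 := Int.units_eq_one_or
      (Equiv.Perm.sign (outerPerm h i (Equiv.swap a.castSucc a.succ)))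
    rcases h5 with h5 | h5
    · rw [h5] at h4
      exact absurd h4 (by decide)
    · exact h5
  have hsw : Equiv.swap a.castSucc a.succ i = i := Equiv.swap_apply_of_ne_of_ne h1 h2
  have e : outerPerm h i (Equiv.swap a.castSucc a.succ) =
      Equiv.swap (operadSlot h i (Sum.inl ⟨a.castSucc, Ne.symm h1⟩))
        (operadSlot h i (Sum.inl ⟨a.succ, Ne.symm h2⟩)) := by
    refine outerPerm_ext h _ _ _ fun s => ?_
    have aux : ∀ (j : Fin (m + 1)) (hj : j = i) (t : {b : Fin (m + 1) // b ≠ j} ⊕ Fin n),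
        operadSlot h j t =
          operadSlot h i (Sum.map (fun b => ⟨b.1, fun e => b.2 (e.trans hj.symm)⟩) id t) := by
      rintro j rfl (t | t) <;> rfl
    rw [aux _ hsw, ← (operadSlot_bijective h i).1.map_swap]
    congr 1
    rcases s with ⟨b, hb⟩ | b
    · by_cases hb1 : b = a.castSucc
      · subst hb1
        simp
      by_cases hb2 : b = a.succ
      · subst hb2
        simp
      rw [Equiv.swap_apply_of_ne_of_ne (by simp [hb1]) (by simp [hb2])]
      simp [Equiv.swap_apply_of_ne_of_ne hb1 hb2]
    · rw [Equiv.swap_apply_of_ne_of_ne (by simp) (by simp)]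
      rfl
  rw [e, Equiv.Perm.sign_swap]
  intro e2
  have := (operadSlot_bijective h i).1 e2
  simp only [Sum.inl.injEq, Subtype.mk.injEq] at this
  exact absurd this (Fin.castSucc_lt_succ).ne

theorem sign_outerPerm {m n r : ℕ} (hn : Odd n) (h : r + 1 = m + n) (i : Fin m)
    (φ : Equiv.Perm (Fin m)) :
    Equiv.Perm.sign (outerPerm h i φ) = Equiv.Perm.sign φ := by
  obtain _ | m := m
  · exact i.elim0
  have hmem : φ ∈ Submonoid.closure
      (Set.range fun a : Fin m => Equiv.swap a.castSucc a.succ) := by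
    rw [Equiv.Perm.mclosure_swap_castSucc_succ]
    trivial
  revert i
  induction hmem using Submonoid.closure_induction with
  | mem x hx =>
    obtain ⟨a, rfl⟩ := hx
    intro i
    rw [sign_outerPerm_swap hn, Equiv.Perm.sign_swap (Fin.castSucc_lt_succ).ne]
  | one =>
    intro i
    rw [outerPerm_one, Equiv.Perm.sign_one, Equiv.Perm.sign_one]
  | mul x y _ _ hx hy =>
    intro i
    rw [outerPerm_mul, Equiv.Perm.sign_mul, Equiv.Perm.sign_mul, hx, hy]

namespace SymmOperad

/-- The subspace of `F` that is all of `F` if the proposition `p` holds and zero otherwise. -/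
def supported (k : Type u) (F : Type w) [Field k] [Field F] [Algebra k F] (p : Prop) :
    Submodule k F where
  carrier := {c | ¬ p → c = 0}
  zero_mem' := fun _ => rfl
  add_mem' := fun {a b} ha hb hp => by rw [ha hp, hb hp, add_zero]
  smul_mem' := fun c a ha hp => by rw [ha hp, smul_zero]

/-- The multiplication of `F`, between subspaces that are zero or all of `F`. -/
def supportedMul (k : Type u) (F : Type w) [Field k] [Field F] [Algebra k F] {p q s : Prop}
    (hs : p → q → s) : supported k F p →ₗ[k] supported k F q →ₗ[k] supported k F s :=
  LinearMap.mk₂ k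
    (fun a b => ⟨a.1 * b.1, fun h => by
      by_cases hp : p
      · by_cases hq : q
        · exact absurd (hs hp hq) h
        · rw [b.2 hq, mul_zero]
      · rw [a.2 hp, zero_mul]⟩)
    (fun a a' b => Subtype.ext (add_mul _ _ _))
    (fun c a b => Subtype.ext (smul_mul_assoc _ _ _))
    (fun a b b' => Subtype.ext (mul_add _ _ _))
    (fun c a b => Subtype.ext (mul_smul_comm _ _ _))

/-- The operad `Com_F` of nonunital commutative `F`-algebras, as an operad over `k`:
`Com_F(n) = F μ_n` for `n ≥ 1` and `Com_F(0) = 0`, with trivial actions of the symmetric groups and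
`μ_m ∘ᵢ μ_n = μ_{m + n - 1}`. The element `c μ_n` is represented by `c`. -/
def Com (k : Type u) (F : Type w) [Field k] [Field F] [Algebra k F] : SymmOperad.{u, w} k where
  obj n := supported k F (1 ≤ n)
  act _ := LinearMap.id
  act_one _ := rfl
  act_mul _ _ _ := rfl
  one := ⟨1, fun h => absurd le_rfl h⟩
  comp h _ := supportedMul k F (fun h1 h2 => by omega)
  comp_one _ x := Subtype.ext (mul_one x.1)
  one_comp x := Subtype.ext (one_mul x.1)
  comp_assoc _ _ _ _ _ _ x y z := Subtype.ext (mul_assoc x.1 y.1 z.1)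
  comp_parallel _ _ _ _ _ _ _ x y z := Subtype.ext (mul_right_comm x.1 y.1 z.1)
  comp_act _ _ _ _ _ := rfl
  act_comp _ _ _ _ _ := rfl

/-- The odd power exterior operad `Ope_F`, as an operad over `k`: `Ope_F(n) = F μ_n` for odd `n` and
`Ope_F(n) = 0` for even `n`, with `μ_n * σ = sgn(σ) μ_n` and `μ_m ∘ᵢ μ_n = μ_{m + n - 1}` for odd
`m` and `n`. The element `c μ_n` is represented by `c`. -/
def Ope (k : Type u) (F : Type w) [Field k] [Field F] [Algebra k F] : SymmOperad.{u, w} k where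
  obj n := supported k F (Odd n)
  act σ := ((Equiv.Perm.sign σ : ℤ) : k) • LinearMap.id
  act_one x := by simp
  act_mul σ τ x := by
    simp only [Equiv.Perm.sign_mul, Units.val_mul, Int.cast_mul, LinearMap.smul_apply,
      LinearMap.id_apply, smul_smul]
    rw [mul_comm]
  one := ⟨1, fun h => absurd odd_one h⟩
  comp h _ := supportedMul k F (fun h1 h2 => by
    obtain ⟨a, ha⟩ := h1
    obtain ⟨b, hb⟩ := h2
    exact ⟨a + b, by omega⟩)
  comp_one _ x := Subtype.ext (mul_one x.1)
  one_comp x := Subtype.ext (one_mul x.1)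
  comp_assoc _ _ _ _ _ _ x y z := Subtype.ext (mul_assoc x.1 y.1 z.1)
  comp_parallel _ _ _ _ _ _ _ x y z := Subtype.ext (mul_right_comm x.1 y.1 z.1)
  comp_act h i x σ y := by
    simp [sign_innerPerm]
  act_comp {m n r} h i φ x y := by
    by_cases hn : Odd n
    · simp [sign_outerPerm hn]
    · have hy : y = 0 := Subtype.ext (y.2 hn)
      simp [hy]

end SymmOperad

/-! Primeness turns the operad into a graded commutative domain, and dehomogenizing that domain
gives a field. A GK-dimension of `1` forces operations of arbitrarily large arity, so the tail
ideals are nonzero. Hence an operation killed by every outer operation of large arity is zero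
(`IsPrime.eq_zero_of_comp`). Identities can therefore be checked after composing with large
operations.

In this way even permutations act trivially in every arity, not only in large ones. Two ideals
measuring the failure of the sign action and of the trivial action have zero composition, so one of
them vanishes: the action is trivial or by signs. Partial composition then depends on its slot only
up to sign, and primeness excludes zero divisors (`IsPrime.eq_zero_or_eq_zero`). For the sign action
outside characteristic two, an operation of even arity squares to zero, hence vanishes. What remains
is an exact independence of the slot and commutativity.

So the sum of the spaces `P(j + 1)`, with `P(j + 1)` in degree `j`, is a graded commutative domain.
Setting a nonzero homogeneous element `a` of positive degree equal to `1` and passing to a suitable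
prime quotient keeps each `P(n)` embedded (`DirectSum.exists_prime_of_graded_domain`). A
transcendental value would put linearly many independent powers into single arities, giving
quadratic growth; thus all values are algebraic over `k`, which gives the embedding into `Com` or
`Ope`.

For the equivalences, composition with `a` makes dimensions nondecreasing in steps of `d`. Bounded
dimensions are thus eventually periodic, which yields finite generation and rationality. Conversely,
finitely many generators have values in a finite extension, which bounds the dimensions. Rationality
together with slow growth forces a long window of periodicity, which the linear recurrence
propagates forever. -/

/-! ### Signs of block permutations -/

/-- Moving a block of `n` slots past one neighbouring slot is a cycle on `n + 1` consecutive slots.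
The parity of `n` is what separates even from odd arities under the sign action. -/
theorem sign_outerPerm_swap_castSucc_succ {m n r : ℕ} (h : r + 1 = (m + 1) + n) (a : Fin m) :
    Equiv.Perm.sign (outerPerm h a.castSucc (Equiv.swap a.castSucc a.succ)) = (-1) ^ n := by
  have ha := a.2
  have hr : NeZero r := ⟨by omega⟩
  have han : (a : ℕ) + n < r := by omega
  have har : (a : ℕ) < r := by omega
  have e : outerPerm h a.castSucc (Equiv.swap a.castSucc a.succ) =
      Fin.cycleIcc ⟨a, har⟩ ⟨(a : ℕ) + n, han⟩ := by
    refine outerPerm_ext h _ _ _ fun s => ?_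
    have hsw : Equiv.swap a.castSucc a.succ a.castSucc = a.succ := Equiv.swap_apply_left _ _
    rcases s with ⟨b, hb⟩ | b
    · have hb' : (b : ℕ) ≠ a := fun e => hb (Fin.ext (by simpa using e))
      rcases lt_or_gt_of_ne hb' with hlt | hgt
      · have h1 : operadSlot h a.castSucc (Sum.inl ⟨b, hb⟩) = ⟨b, by omega⟩ := by
          simp [operadSlot, hlt]
        have h2 : Equiv.swap a.castSucc a.succ b = b := by
          apply Equiv.swap_apply_of_ne_of_ne hb
          intro e
          have := congrArg Fin.val e
          simp at this
          omega
        rw [h1, Fin.cycleIcc_of_lt (by simpa [Fin.lt_def] using hlt)]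
        apply Fin.ext
        have h3 : (b : ℕ) < a + 1 := by omega
        simp [operadSlot, h2, hsw, h3]
      · by_cases hbs : b = a.succ
        · subst hbs
          have h1 : operadSlot h a.castSucc (Sum.inl ⟨a.succ, hb⟩) = ⟨(a : ℕ) + n, han⟩ := by
            apply Fin.ext
            simp [operadSlot]
          rw [h1, Fin.cycleIcc_of_last (by simp [Fin.le_def])]
          apply Fin.ext
          simp [operadSlot]
        · have h2 : Equiv.swap a.castSucc a.succ b = b :=
            Equiv.swap_apply_of_ne_of_ne hb hbs
          have h4 : (b : ℕ) ≠ a + 1 := fun e => hbs (Fin.ext (by simpa using e))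
          have h5 : ¬ (b : ℕ) < a := by omega
          have h6 : ¬ (b : ℕ) < a + 1 := by omega
          have hb2 := b.2
          have h1 : operadSlot h a.castSucc (Sum.inl ⟨b, hb⟩) =
              ⟨(b : ℕ) + n - 1, by omega⟩ := by
            simp [operadSlot, h5]
          rw [h1, Fin.cycleIcc_of_gt (by simp only [Fin.lt_def]; omega)]
          apply Fin.ext
          simp [operadSlot, h2, hsw, h6]
    · have hb := b.2
      have h1 : operadSlot h a.castSucc (Sum.inr b) = ⟨(a : ℕ) + b, by omega⟩ := by
        simp [operadSlot]
      rw [h1, Fin.cycleIcc_of_ge_of_lt (by simp [Fin.le_def]) (by simp [Fin.lt_def])]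
      apply Fin.ext
      rw [Fin.val_add_one_of_lt' (by simp only; omega)]
      simp [operadSlot, hsw]
      omega
  rw [e, Fin.sign_cycleIcc_of_le (by simp [Fin.le_def])]
  simp

theorem sign_outerPerm_swap_of_ne {m n r : ℕ} (h : r + 1 = m + n) {i b c : Fin m}
    (hb : b ≠ i) (hc : c ≠ i) (hbc : b ≠ c) :
    Equiv.Perm.sign (outerPerm h i (Equiv.swap b c)) = -1 := by
  have hsw : Equiv.swap b c i = i := Equiv.swap_apply_of_ne_of_ne hb.symm hc.symm
  have e : outerPerm h i (Equiv.swap b c) =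
      Equiv.swap (operadSlot h i (Sum.inl ⟨b, hb⟩)) (operadSlot h i (Sum.inl ⟨c, hc⟩)) := by
    refine outerPerm_ext h _ _ _ fun s => ?_
    have aux : ∀ (j : Fin m) (hj : j = i) (t : {b : Fin m // b ≠ j} ⊕ Fin n),
        operadSlot h j t =
          operadSlot h i (Sum.map (fun b => ⟨b.1, fun e => b.2 (e.trans hj.symm)⟩) id t) := by
      rintro j rfl (t | t) <;> rfl
    rw [aux _ hsw, ← (operadSlot_bijective h i).1.map_swap]
    congr 1
    rcases s with ⟨a, ha⟩ | a
    · by_cases hb1 : a = b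
      · subst hb1
        simp
      by_cases hb2 : a = c
      · subst hb2
        simp
      rw [Equiv.swap_apply_of_ne_of_ne (by simp [hb1]) (by simp [hb2])]
      simp [Equiv.swap_apply_of_ne_of_ne hb1 hb2]
    · rw [Equiv.swap_apply_of_ne_of_ne (by simp) (by simp)]
      rfl
  rw [e, Equiv.Perm.sign_swap]
  intro e2
  have := (operadSlot_bijective h i).1 e2
  simp only [Sum.inl.injEq, Subtype.mk.injEq] at this
  exact hbc this

/-! ### Primeness and the actions of the symmetric groups -/

namespace SymmOperad

variable {k : Type u} [Field k] {P : SymmOperad.{u, v} k}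

theorem IsPrime.eq_bot_or_eq_bot (hP : P.IsPrime) (I J : OpIdeal P)
    (H : ∀ {m n r : ℕ} (h : r + 1 = m + n) (i : Fin m), ∀ x ∈ I.carrier m, ∀ y ∈ J.carrier n,
      P.comp h i x y = 0) :
    (∀ n, I.carrier n = ⊥) ∨ (∀ n, J.carrier n = ⊥) := by
  by_contra! hne
  obtain ⟨r, hr⟩ := hP I J hne.1 hne.2
  refine hr (Submodule.span_eq_bot.2 ?_)
  rintro _ ⟨m, n, h, i, σ, x, hx, y, hy, rfl⟩
  rw [H h i x hx y hy, map_zero]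

/-- The ideal of all operations of arity at least `N`. -/
def tailIdeal (hred : P.IsReduced) (N : ℕ) : OpIdeal P where
  carrier n :=
    { carrier := {x | n < N → x = 0}
      zero_mem' := fun _ => rfl
      add_mem' := fun ha hb h => by rw [ha h, hb h, add_zero]
      smul_mem' := fun c x hx h => by rw [hx h, smul_zero] }
  act_mem σ x hx h := by rw [hx h, map_zero]
  comp_mem_left {m n r} h i x y hx hr := by
    obtain rfl | hn := Nat.eq_zero_or_pos n
    · rw [hred y, map_zero]
    · rw [hx (by omega), map_zero, LinearMap.zero_apply]
  comp_mem_right {m n r} h i x y hy hr := by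
    have := i.2
    rw [hy (by omega), map_zero]

/-- The right annihilator of the operations of arity at least `N`. -/
def tailAnnihilator (P : SymmOperad.{u, v} k) (N : ℕ) : OpIdeal P where
  carrier n :=
    { carrier := {y | ∀ {m r : ℕ} (h : r + 1 = m + n) (i : Fin m) (x : P.obj m), N ≤ m →
        P.comp h i x y = 0}
      zero_mem' := fun _ _ _ _ => map_zero _
      add_mem' := fun ha hb _ _ h i x hm => by rw [map_add, ha h i x hm, hb h i x hm, add_zero]
      smul_mem' := fun c x hx _ _ h i z hm => by rw [map_smul, hx h i z hm, smul_zero] }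
  act_mem σ y hy _ _ h i x hm := by rw [P.comp_act, hy h i x hm, map_zero]
  comp_mem_left {m n q} hq j y z hy l r h i x hm := by
    have := i.2
    have := j.2
    rw [← P.comp_assoc (p := l + m - 1) (by omega) (by omega) hq h i j x y z,
      hy _ i x hm, map_zero, LinearMap.zero_apply]
  comp_mem_right {m n q} hq j z y hy l r h i x hm := by
    have := i.2
    have := j.2
    rw [← P.comp_assoc (p := l + m - 1) (by omega) (by omega) hq h i j x z y]
    exact hy _ _ _ (by omega)

/-- There are nonzero operations of arbitrarily large arity. -/
def IsUnbounded (P : SymmOperad.{u, v} k) : Prop := ∀ N, ∃ n, N ≤ n ∧ ∃ x : P.obj n, x ≠ 0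

/-- The tail ideal is nonzero and its composition with its right annihilator is zero, so primeness
kills the annihilator. This is the tool for descending from large arities to small ones. -/
theorem IsPrime.eq_zero_of_comp (hP : P.IsPrime) (hred : P.IsReduced) (hinf : P.IsUnbounded)
    (N : ℕ) {n : ℕ} (y : P.obj n)
    (hy : ∀ {m r : ℕ} (h : r + 1 = m + n) (i : Fin m) (x : P.obj m), N ≤ m →
      P.comp h i x y = 0) : y = 0 := by
  rcases hP.eq_bot_or_eq_bot (tailIdeal hred N) (tailAnnihilator P N) (fun {m n r} h i x hx y hy => by
      by_cases hm : N ≤ m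
      · exact hy h i x hm
      · rw [hx (not_le.1 hm), map_zero, LinearMap.zero_apply]) with h0 | h0
  · obtain ⟨n, hn, x, hx⟩ := hinf N
    have : x ∈ (tailIdeal hred N).carrier n := fun h => absurd hn (by omega)
    rw [h0 n] at this
    exact absurd this hx
  · have : y ∈ (tailAnnihilator P N).carrier n := hy
    rw [h0 n] at this
    exact this

/-- Composing an outer operation with `x * σ - x` turns `σ` into an inner permutation of the same
sign in a large arity, where even permutations already act trivially. -/
theorem IsPrime.act_of_sign_eq_one (hP : P.IsPrime) (hred : P.IsReduced) (hinf : P.IsUnbounded)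
    (hA : P.IsAlmostATrivial) {n : ℕ} (σ : Equiv.Perm (Fin n)) (hσ : Equiv.Perm.sign σ = 1)
    (x : P.obj n) : P.act σ x = x := by
  obtain ⟨N, hN⟩ := hA
  obtain rfl | hn := Nat.eq_zero_or_pos n
  · rw [hred (P.act σ x), hred x]
  refine sub_eq_zero.1 (hP.eq_zero_of_comp hred hinf N _ fun {m r} h i z hm => ?_)
  rw [map_sub, P.comp_act, hN r (by omega), sub_self]
  rw [Equiv.Perm.mem_alternatingGroup, sign_innerPerm, hσ]

theorem act_eq_act (hE : ∀ {n : ℕ} (σ : Equiv.Perm (Fin n)), Equiv.Perm.sign σ = 1 →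
      ∀ x : P.obj n, P.act σ x = x)
    {n : ℕ} {σ τ : Equiv.Perm (Fin n)} (h : Equiv.Perm.sign σ = Equiv.Perm.sign τ)
    (x : P.obj n) : P.act σ x = P.act τ x := by
  have : σ = τ * (τ⁻¹ * σ) := by group
  rw [this, P.act_mul, hE]
  simp [h]

/-- With at least three slots, two of them avoid `i`. Since only the sign of `σ` matters, it can be
replaced by their transposition, which remains a transposition after composition. -/
theorem comp_act_of_odd (hE : ∀ {n : ℕ} (σ : Equiv.Perm (Fin n)), Equiv.Perm.sign σ = 1 →
      ∀ x : P.obj n, P.act σ x = x)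
    {m n r : ℕ} (h : r + 1 = m + n) (i : Fin m) (hm : 3 ≤ m) {σ : Equiv.Perm (Fin m)}
    (hσ : Equiv.Perm.sign σ = -1) {τ : Equiv.Perm (Fin r)} (hτ : Equiv.Perm.sign τ = -1)
    (x : P.obj m) (y : P.obj n) : P.comp h i (P.act σ x) y = P.act τ (P.comp h i x y) := by
  obtain ⟨b, c, hb, hc, hbc⟩ : ∃ b c : Fin m, b ≠ i ∧ c ≠ i ∧ b ≠ c := by
    have : 2 < Fintype.card (Fin m) := by simpa using Nat.lt_of_succ_le hm
    obtain ⟨b, hb⟩ := Fintype.exists_ne_of_one_lt_card (by omega : 1 < Fintype.card (Fin m)) i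
    obtain ⟨c, hc⟩ := Finset.exists_mem_notMem_of_card_lt_card
      (s := {i, b}) (t := (Finset.univ : Finset (Fin m)))
      (lt_of_le_of_lt Finset.card_le_two (by simpa using Nat.lt_of_succ_le hm))
    simp only [Finset.mem_univ, Finset.mem_insert, Finset.mem_singleton, not_or, true_and] at hc
    exact ⟨b, c, hb, hc.1, Ne.symm hc.2⟩
  rw [act_eq_act hE (hσ.trans (Equiv.Perm.sign_swap hbc).symm), P.act_comp,
    act_eq_act hE ((sign_outerPerm_swap_of_ne h hb hc hbc).trans hτ.symm),
    Equiv.swap_apply_of_ne_of_ne hb.symm hc.symm]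

/-- The ideal generated by the elements `x + s (x * σ)` with `σ` odd and `x` of arity at least
three. -/
def oddIdeal (hred : P.IsReduced) (hE : ∀ {n : ℕ} (σ : Equiv.Perm (Fin n)),
      Equiv.Perm.sign σ = 1 → ∀ x : P.obj n, P.act σ x = x) (s : k) : OpIdeal P where
  carrier n := Submodule.span k {z | 3 ≤ n ∧ ∃ (x : P.obj n) (σ : Equiv.Perm (Fin n)),
    Equiv.Perm.sign σ = -1 ∧ z = x + s • P.act σ x}
  act_mem {n} ρ x hx := by
    revert x
    change Submodule.span k _ ≤ (Submodule.span k _).comap (P.act ρ)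
    rw [Submodule.span_le]
    rintro _ ⟨hn, x, σ, hσ, rfl⟩
    refine Submodule.subset_span ⟨hn, P.act ρ x, σ, hσ, ?_⟩
    have : Equiv.Perm.sign (σ * ρ) = Equiv.Perm.sign (ρ * σ) := by simp [mul_comm]
    rw [map_add, map_smul, ← P.act_mul, ← P.act_mul, act_eq_act hE this]
  comp_mem_left {m n r} h i x y hx := by
    revert x
    change Submodule.span k _ ≤ (Submodule.span k _).comap ((P.comp h i).flip y)
    rw [Submodule.span_le]
    rintro _ ⟨hm, x, σ, hσ, rfl⟩
    obtain rfl | hn := Nat.eq_zero_or_pos n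
    · simp [hred y]
    have hr : 3 ≤ r := by omega
    obtain ⟨τ, hτ⟩ : ∃ τ : Equiv.Perm (Fin r), Equiv.Perm.sign τ = -1 :=
      ⟨Equiv.swap ⟨0, by omega⟩ ⟨1, by omega⟩, Equiv.Perm.sign_swap (by simp)⟩
    refine Submodule.subset_span ⟨hr, P.comp h i x y, τ, hτ, ?_⟩
    rw [LinearMap.flip_apply, map_add, map_smul, LinearMap.add_apply, LinearMap.smul_apply,
      comp_act_of_odd hE h i hm hσ hτ]
  comp_mem_right {m n r} h i x y hy := by
    revert y
    change Submodule.span k _ ≤ (Submodule.span k _).comap (P.comp h i x)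
    rw [Submodule.span_le]
    rintro _ ⟨hn, y, σ, hσ, rfl⟩
    have := i.2
    refine Submodule.subset_span ⟨by omega, P.comp h i x y, innerPerm h i σ,
      (sign_innerPerm h i σ).trans hσ, ?_⟩
    rw [map_add, map_smul, P.comp_act]

/-- The value `s = 1` encodes the sign action and `s = -1` the trivial one. The two corresponding
ideals annihilate each other, so at least one of them vanishes. -/
theorem IsPrime.act_odd (hP : P.IsPrime) (hred : P.IsReduced) (hinf : P.IsUnbounded)
    (hE : ∀ {n : ℕ} (σ : Equiv.Perm (Fin n)), Equiv.Perm.sign σ = 1 →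
      ∀ x : P.obj n, P.act σ x = x) :
    ∃ s : k, (s = 1 ∨ s = -1) ∧ ∀ {n : ℕ} (σ : Equiv.Perm (Fin n)), Equiv.Perm.sign σ = -1 →
      ∀ x : P.obj n, x + s • P.act σ x = 0 := by
  have key : ∀ s : k, (∀ n, (oddIdeal hred hE s).carrier n = ⊥) →
      ∀ {n : ℕ} (σ : Equiv.Perm (Fin n)), Equiv.Perm.sign σ = -1 →
      ∀ x : P.obj n, x + s • P.act σ x = 0 := by
    intro s hs n σ hσ x
    have h3 : ∀ {n : ℕ}, 3 ≤ n → ∀ (σ : Equiv.Perm (Fin n)), Equiv.Perm.sign σ = -1 →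
        ∀ x : P.obj n, x + s • P.act σ x = 0 := by
      intro n hn σ hσ x
      have : x + s • P.act σ x ∈ (oddIdeal hred hE s).carrier n :=
        Submodule.subset_span ⟨hn, x, σ, hσ, rfl⟩
      rwa [hs n, Submodule.mem_bot] at this
    obtain rfl | hn := Nat.eq_zero_or_pos n
    · exact hred _
    -- The ideal only sees arities at least three; smaller ones are reached by composing with outer
    -- operations of arity at least three.
    refine hP.eq_zero_of_comp hred hinf 3 _ fun {m r} h i z hm => ?_
    rw [map_add, map_smul, P.comp_act]
    exact h3 (by omega) _ ((sign_innerPerm h i σ).trans hσ) _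
  -- With `X = x ∘ᵢ y` and `ρ` the odd inner permutation, `(x + x * σ) ∘ᵢ (y - y * τ)` equals `X - X
  -- * ρ + X * ρ - X * (ρ * ρ)`, which is zero because `ρ * ρ` is even.
  rcases hP.eq_bot_or_eq_bot (oddIdeal hred hE 1) (oddIdeal hred hE (-1)) (by
    intro m n r h i x hx y hy
    have h1 : (oddIdeal hred hE 1).carrier m ≤ LinearMap.ker ((P.comp h i).flip y) := by
      refine Submodule.span_le.2 ?_
      rintro _ ⟨hm, x, σ, hσ, rfl⟩
      have h2 : (oddIdeal hred hE (-1)).carrier n ≤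
          LinearMap.ker (P.comp h i (x + (1 : k) • P.act σ x)) := by
        refine Submodule.span_le.2 ?_
        rintro _ ⟨hn, y, τ, hτ, rfl⟩
        have h3 : Equiv.Perm.sign (innerPerm h i τ) = -1 := (sign_innerPerm h i τ).trans hτ
        have hx := comp_act_of_odd hE h i hm hσ h3 x y
        have hxx : P.act (innerPerm h i τ) (P.act (innerPerm h i τ) (P.comp h i x y)) =
            P.comp h i x y := by
          rw [← P.act_mul, hE _ (by simp [h3])]
        rw [SetLike.mem_coe, LinearMap.mem_ker, neg_smul, one_smul, one_smul]
        simp only [map_add, map_neg, LinearMap.add_apply, P.comp_act, hx, hxx]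
        abel
      exact h2 hy
    exact h1 hx) with h0 | h0
  · exact ⟨1, Or.inl rfl, key 1 h0⟩
  · exact ⟨-1, Or.inr rfl, key (-1) h0⟩

/-- All actions of the symmetric groups are trivial. -/
def IsTrivialAction (P : SymmOperad.{u, v} k) : Prop :=
  ∀ {n : ℕ} (σ : Equiv.Perm (Fin n)) (x : P.obj n), P.act σ x = x

/-- The symmetric groups act by the sign character. -/
def IsSignAction (P : SymmOperad.{u, v} k) : Prop :=
  ∀ {n : ℕ} (σ : Equiv.Perm (Fin n)) (x : P.obj n),
    P.act σ x = ((Equiv.Perm.sign σ : ℤ) : k) • x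

theorem IsPrime.isTrivialAction_or_isSignAction (hP : P.IsPrime) (hred : P.IsReduced)
    (hinf : P.IsUnbounded) (hA : P.IsAlmostATrivial) : P.IsTrivialAction ∨ P.IsSignAction := by
  have hE := fun {n} σ hσ x => hP.act_of_sign_eq_one hred hinf hA (n := n) σ hσ x
  obtain ⟨s, hs, hodd⟩ := hP.act_odd hred hinf hE
  rcases hs with rfl | rfl
  · refine Or.inr fun {n} σ x => ?_
    rcases Int.units_eq_one_or (Equiv.Perm.sign σ) with h | h
    · simp [hE σ h x, h]
    · have := hodd σ h x
      rw [one_smul] at this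
      simp [h, eq_neg_of_add_eq_zero_right this]
  · refine Or.inl fun {n} σ x => ?_
    rcases Int.units_eq_one_or (Equiv.Perm.sign σ) with h | h
    · exact hE σ h x
    · have := hodd σ h x
      rw [neg_smul, one_smul, ← sub_eq_add_neg, sub_eq_zero] at this
      exact this.symm

/-! ### Composition up to sign and absence of zero divisors -/

/-- Every permutation acts as the identity or as its negative on each operation. -/
def IsSignedAction (P : SymmOperad.{u, v} k) : Prop :=
  ∀ {n : ℕ} (σ : Equiv.Perm (Fin n)) (x : P.obj n), P.act σ x = x ∨ P.act σ x = -x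

theorem IsTrivialAction.isSignedAction (h : P.IsTrivialAction) : P.IsSignedAction :=
  fun σ x => Or.inl (h σ x)

theorem IsSignAction.isSignedAction (h : P.IsSignAction) : P.IsSignedAction := fun σ x => by
  rw [h σ x]
  rcases Int.units_eq_one_or (Equiv.Perm.sign σ) with h | h <;> simp [h]

theorem IsSignedAction.comp_index (H : P.IsSignedAction) {m n r : ℕ} (h : r + 1 = m + n)
    (i j : Fin m) (x : P.obj m) (y : P.obj n) :
    P.comp h i x y = P.comp h j x y ∨ P.comp h i x y = -P.comp h j x y := by
  have e := P.act_comp h i (Equiv.swap i j) x y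
  rw [Equiv.swap_apply_left] at e
  rcases H (Equiv.swap i j) x with h1 | h1 <;>
    rcases H (outerPerm h i (Equiv.swap i j)) (P.comp h j x y) with h2 | h2 <;>
    rw [h1, h2] at e
  · exact Or.inl e
  · exact Or.inr e
  · rw [map_neg, LinearMap.neg_apply] at e
    exact Or.inr (neg_eq_iff_eq_neg.1 e)
  · rw [map_neg, LinearMap.neg_apply] at e
    exact Or.inl (neg_injective e)

theorem IsSignedAction.comp_eq_zero (H : P.IsSignedAction) {m n r : ℕ} {h : r + 1 = m + n}
    {i : Fin m} (j : Fin m) {x : P.obj m} {y : P.obj n} (h0 : P.comp h i x y = 0) :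
    P.comp h j x y = 0 := by
  rcases H.comp_index h j i x y with e | e <;> simp [e, h0]

/-- Changing slots costs only signs, so every case reduces to the parallel axiom at slots `0` and
`1`; this is why `x` needs two inputs. -/
theorem IsSignedAction.comp_right_comm (H : P.IsSignedAction) {l m n p q r : ℕ}
    (hp : p + 1 = l + m) (hr : r + 1 = p + n) (hq : q + 1 = l + n) (hr' : r + 1 = q + m)
    (hl : 2 ≤ l) (i : Fin l) (j : Fin p) (a : Fin q) (x : P.obj l) (y : P.obj m) (z : P.obj n) :
    P.comp hr j (P.comp hp i x y) z = P.comp hr' a (P.comp hq ⟨1, hl⟩ x z) y ∨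
      P.comp hr j (P.comp hp i x y) z = -P.comp hr' a (P.comp hq ⟨1, hl⟩ x z) y := by
  have e := P.comp_parallel hp hr hq hr' ⟨0, by omega⟩ ⟨1, hl⟩ Nat.zero_lt_one x y z
  have h1 := H.comp_index hp i ⟨0, by omega⟩ x y
  have h2 := H.comp_index hr j ⟨1 + m - 1, by omega⟩ (P.comp hp ⟨0, by omega⟩ x y) z
  have h3 := H.comp_index hr' ⟨0, by omega⟩ a (P.comp hq ⟨1, hl⟩ x z) y
  simp only at e
  rw [e] at h2
  rcases h1 with h1 | h1 <;> rcases h2 with h2 | h2 <;> rcases h3 with h3 | h3 <;>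
    simp [h1, h2, h3]

/-- The operations `w` such that `(x ∘ y) ∘ w = 0` for all `x` of arity at least two. -/
def IsSignedAction.annihilatorOf (H : P.IsSignedAction) {m : ℕ} (y : P.obj m) : OpIdeal P where
  carrier n :=
    { carrier := {w | ∀ {l p r : ℕ} (hp : p + 1 = l + m) (hr : r + 1 = p + n) (i : Fin l)
        (j : Fin p) (x : P.obj l), 2 ≤ l → P.comp hr j (P.comp hp i x y) w = 0}
      zero_mem' := fun _ _ _ _ _ _ => map_zero _
      add_mem' := fun ha hb _ _ _ hp hr i j x hl => by
        rw [map_add, ha hp hr i j x hl, hb hp hr i j x hl, add_zero]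
      smul_mem' := fun c w hw _ _ _ hp hr i j x hl => by
        rw [map_smul, hw hp hr i j x hl, smul_zero] }
  act_mem σ w hw _ _ _ hp hr i j x hl := by rw [P.comp_act, hw hp hr i j x hl, map_zero]
  comp_mem_left {a b n} hn t w z hw l p r hp hr i j x hl := by
    have := t.2
    rw [← P.comp_assoc (p := p + a - 1) (by omega) (by omega) hn hr j t, hw _ _ i j x hl,
      map_zero, LinearMap.zero_apply]
  comp_mem_right {a b n} hn t z w hw l p r hp hr i j x hl := by
    have := t.2
    have := j.2
    rw [← P.comp_assoc (p := p + a - 1) (by omega) (by omega) hn hr j t]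
    have h0 := hw (l := l + a - 1) (p := p + a - 1) (r := r) (by omega) (by omega)
      ⟨0, by omega⟩ ⟨(j : ℕ) + t, by omega⟩ (P.comp (by omega) ⟨1, hl⟩ x z) (by omega)
    rcases H.comp_right_comm hp (n := a) (r := p + a - 1) (q := l + a - 1) (by omega) (by omega)
      (by omega) hl i j ⟨0, by omega⟩ x y z with e | e
    · rw [e, h0]
    · rw [e, map_neg, LinearMap.neg_apply, h0, neg_zero]

/-- The left annihilator of an ideal. -/
def IsSignedAction.leftAnnihilator (H : P.IsSignedAction) (hred : P.IsReduced) (J : OpIdeal P) :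
    OpIdeal P where
  carrier m :=
    { carrier := {u | ∀ {n r : ℕ} (h : r + 1 = m + n) (j : Fin m), ∀ w ∈ J.carrier n,
        P.comp h j u w = 0}
      zero_mem' := fun _ _ _ _ => by rw [map_zero, LinearMap.zero_apply]
      add_mem' := fun ha hb _ _ h j w hw => by
        rw [map_add, LinearMap.add_apply, ha h j w hw, hb h j w hw, add_zero]
      smul_mem' := fun c u hu _ _ h j w hw => by
        rw [map_smul, LinearMap.smul_apply, hu h j w hw, smul_zero] }
  act_mem σ u hu _ _ h j w hw := by rw [P.act_comp, hu h _ w hw, map_zero]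
  comp_mem_left {a b m} hm i u z hu n r h j w hw := by
    obtain rfl | hb := Nat.eq_zero_or_pos b
    · rw [hred z, map_zero, map_zero, LinearMap.zero_apply]
    have := i.2
    refine H.comp_eq_zero (i := ⟨(i : ℕ) + (⟨0, hb⟩ : Fin b), by simp only; omega⟩) j ?_
    rw [P.comp_assoc hm h (q := b + n - 1) (by omega) (by omega) i ⟨0, hb⟩]
    exact hu _ _ _ (J.comp_mem_right _ _ _ hw)
  comp_mem_right {a b m} hm i z u hu n r h j w hw := by
    obtain rfl | hb := Nat.eq_zero_or_pos b
    · rw [hred u, map_zero, map_zero, LinearMap.zero_apply]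
    have := i.2
    refine H.comp_eq_zero (i := ⟨(i : ℕ) + (⟨0, hb⟩ : Fin b), by simp only; omega⟩) j ?_
    rw [P.comp_assoc hm h (q := b + n - 1) (by omega) (by omega) i ⟨0, hb⟩, hu _ _ w hw, map_zero]

/-- Let `J` be the ideal of all `w` with `(x ∘ y) ∘ w = 0` for `x` of arity at least two, and `L`
its left annihilator. Then `L ∘ J = 0`. If `L = 0`, all the `x ∘ y` vanish, hence so does `y`. If `J
= 0`, then `z` vanishes, since associativity puts it in `J`. -/
theorem IsPrime.eq_zero_or_eq_zero (hP : P.IsPrime) (hred : P.IsReduced) (hinf : P.IsUnbounded)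
    (H : P.IsSignedAction) {m n r : ℕ} (h : r + 1 = m + n) (i : Fin m) (y : P.obj m) (z : P.obj n)
    (h0 : P.comp h i y z = 0) : y = 0 ∨ z = 0 := by
  rcases hP.eq_bot_or_eq_bot (H.leftAnnihilator hred (H.annihilatorOf y)) (H.annihilatorOf y)
    (fun h i x hx y hy => hx h i y hy) with h1 | h1
  · left
    refine hP.eq_zero_of_comp hred hinf 2 y fun {l p} hp j x hl => ?_
    have : P.comp hp j x y ∈ (H.leftAnnihilator hred (H.annihilatorOf y)).carrier p :=
      fun {n r} h c w hw => hw hp h j c x hl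
    rwa [h1 p] at this
  · right
    have hi := i.2
    have : z ∈ (H.annihilatorOf y).carrier n := by
      intro l p q hp hq j c x hl
      refine H.comp_eq_zero (i := ⟨(j : ℕ) + i, by omega⟩) c ?_
      rw [P.comp_assoc hp hq h (by omega) j i, h0, map_zero]
    rwa [h1 n] at this

/-! ### Even arities, independence of the slot, and commutativity -/

theorem IsSignAction.comp_even_index (H : P.IsSignAction) {m n r : ℕ} (h : r + 1 = m + n)
    (hn : Even n) (x : P.obj m) (y : P.obj n) (i : ℕ) (hi : i < m) :
    P.comp h ⟨i, hi⟩ x y = (-1 : k) ^ i • P.comp h ⟨0, by omega⟩ x y := by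
  induction i with
  | zero => simp
  | succ i ih =>
    obtain _ | m := m
    · omega
    have e := P.act_comp h (⟨i, by omega⟩ : Fin m).castSucc
      (Equiv.swap (⟨i, by omega⟩ : Fin m).castSucc (⟨i, by omega⟩ : Fin m).succ) x y
    rw [Equiv.swap_apply_left, H, H, sign_outerPerm_swap_castSucc_succ, hn.neg_one_pow,
      Equiv.Perm.sign_swap (Fin.castSucc_lt_succ).ne] at e
    simp only [Fin.castSucc_mk, Fin.succ_mk, Units.val_one, Int.cast_one, one_smul, Units.val_neg,
      Int.cast_neg, neg_smul, map_neg, LinearMap.neg_apply] at e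
    rw [← e, ih (by omega), pow_succ, mul_neg_one, neg_smul]

/-- Inserting two copies of `y` into slots `0` and `1` of `x` in either order gives the same result,
but moving each composition to slot `0` gives opposite signs. Hence `2 (x ∘ (y ∘ y)) = 0`, so `y ∘ y
= 0`, and there are no zero divisors. -/
theorem IsPrime.eq_zero_of_even (hP : P.IsPrime) (hred : P.IsReduced) (hinf : P.IsUnbounded)
    (H : P.IsSignAction) (h2 : (2 : k) ≠ 0) {n : ℕ} (hn : Even n) (y : P.obj n) : y = 0 := by
  obtain rfl | hpos := Nat.eq_zero_or_pos n
  · exact hred y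
  have hyy : P.comp (r := n + n - 1) (by omega) ⟨0, hpos⟩ y y = 0 := by
    refine hP.eq_zero_of_comp hred hinf 2 _ fun {l r} h i x hl => ?_
    refine IsSignedAction.comp_eq_zero H.isSignedAction (i := ⟨0, by omega⟩) i ?_
    have hp : l + n - 1 + 1 = l + n := by omega
    have hr : r + 1 = l + n - 1 + n := by omega
    have ea := P.comp_assoc hp hr (by omega) h ⟨0, by omega⟩ ⟨0, hpos⟩ x y y
    have ep := P.comp_parallel hp hr hp hr ⟨0, by omega⟩ ⟨1, hl⟩ Nat.zero_lt_one x y y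
    rw [H.comp_even_index hr hn _ _ _ (by simp only; omega),
      H.comp_even_index hp hn x y 1 hl, map_smul, LinearMap.smul_apply] at ep
    have e1 : 1 + n - 1 = n := by omega
    simp only [e1, hn.neg_one_pow, one_smul, pow_one, neg_smul] at ep
    rw [← ea]
    simp only [Nat.add_zero]
    have := add_eq_zero_iff_eq_neg.2 ep
    rw [← two_smul k] at this
    exact (smul_eq_zero.1 this).resolve_left h2
  rcases hP.eq_zero_or_eq_zero hred hinf H.isSignedAction _ _ y y hyy with h | h <;> exact h

/-- The symmetric groups act by signs and there are no operations of even arity. -/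
def IsOddSignAction (P : SymmOperad.{u, v} k) : Prop :=
  P.IsSignAction ∧ ∀ {n : ℕ}, Even n → ∀ y : P.obj n, y = 0

theorem IsPrime.isTrivialAction_or_isOddSignAction (hP : P.IsPrime) (hred : P.IsReduced)
    (hinf : P.IsUnbounded) (hA : P.IsAlmostATrivial) :
    P.IsTrivialAction ∨ P.IsOddSignAction := by
  rcases hP.isTrivialAction_or_isSignAction hred hinf hA with h | h
  · exact Or.inl h
  by_cases h2 : (2 : k) = 0
  -- In characteristic two the sign action is the trivial action.
  · refine Or.inl fun σ x => ?_
    have h3 : (-1 : k) = 1 := by linear_combination -h2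
    rw [h σ x]
    rcases Int.units_eq_one_or (Equiv.Perm.sign σ) with h | h <;> simp [h, h3]
  · exact Or.inr ⟨h, fun hn y => hP.eq_zero_of_even hred hinf h h2 hn y⟩

theorem comp_index (H : P.IsTrivialAction ∨ P.IsOddSignAction) {m n r : ℕ} (h : r + 1 = m + n)
    (i j : Fin m) (x : P.obj m) (y : P.obj n) : P.comp h i x y = P.comp h j x y := by
  have e := P.act_comp h i (Equiv.swap i j) x y
  rw [Equiv.swap_apply_left] at e
  rcases H with H | ⟨H, H2⟩
  · rwa [H, H] at e
  · rcases Nat.even_or_odd n with hn | hn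
    · simp [H2 hn y]
    · rw [H, H, sign_outerPerm hn, map_smul, LinearMap.smul_apply] at e
      refine smul_right_injective _ ?_ e
      rcases Int.units_eq_one_or (Equiv.Perm.sign (Equiv.swap i j)) with h | h <;> simp [h]

theorem isSignedAction_of_or (H : P.IsTrivialAction ∨ P.IsOddSignAction) : P.IsSignedAction :=
  H.elim (fun h => h.isSignedAction) (fun h => IsSignAction.isSignedAction h.1)

/-- Both sides agree after composition with any `x` of arity at least two: `y` and `z` are then
inserted in different slots of `x`, where the order is irrelevant. -/
theorem IsPrime.comp_comm (hP : P.IsPrime) (hred : P.IsReduced) (hinf : P.IsUnbounded)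
    (H : P.IsTrivialAction ∨ P.IsOddSignAction) {m n r : ℕ} (h : r + 1 = m + n)
    (h' : r + 1 = n + m) (i : Fin m) (j : Fin n) (y : P.obj m) (z : P.obj n) :
    P.comp h i y z = P.comp h' j z y := by
  refine sub_eq_zero.1 (hP.eq_zero_of_comp hred hinf 2 _ fun {l q} hq a x hl => ?_)
  have hi := i.2
  have hj := j.2
  have e1 : l + m - 1 + 1 = l + m := by omega
  have e2 : q + 1 = l + m - 1 + n := by omega
  have e3 : l + n - 1 + 1 = l + n := by omega
  have e4 : q + 1 = l + n - 1 + m := by omega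
  rw [map_sub, ← P.comp_assoc e1 e2 h hq a i, ← P.comp_assoc e3 e4 h' hq a j, sub_eq_zero,
    comp_index H e1 a ⟨0, by omega⟩, comp_index H e2 _ ⟨1 + m - 1, by omega⟩,
    P.comp_parallel e1 e2 e3 e4 ⟨0, by omega⟩ ⟨1, hl⟩ Nat.zero_lt_one,
    comp_index H e3 a ⟨1, hl⟩]
  exact comp_index H _ _ _ _ _

end SymmOperad

/-! ### Dehomogenization of a graded domain -/

open DirectSum in
theorem DirectSum.of_mul_apply_add {A : ℕ → Type v} [∀ i, AddCommGroup (A i)] [GCommRing A]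
    {d : ℕ} (a : A d) (b : ⨁ i, A i) (j : ℕ) :
    (of A d a * b) (d + j) = GradedMonoid.GMul.mul a (b j) := by
  induction b using DirectSum.induction_on with
  | zero => rw [mul_zero, zero_apply, zero_apply, GNonUnitalNonAssocSemiring.mul_zero]
  | of i x =>
    rw [of_mul_of]
    by_cases h : i = j
    · subst h
      rw [of_eq_same, of_eq_same]
    · rw [of_eq_of_ne _ _ _ (by omega), of_eq_of_ne _ _ _ (Ne.symm h),
        GNonUnitalNonAssocSemiring.mul_zero]
  | add x y hx hy =>
    rw [mul_add, add_apply, hx, hy, add_apply, GNonUnitalNonAssocSemiring.mul_add]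

open DirectSum in
theorem DirectSum.of_mul_apply_of_lt {A : ℕ → Type v} [∀ i, AddCommGroup (A i)] [GCommRing A]
    {d : ℕ} (a : A d) (b : ⨁ i, A i) {n : ℕ} (hn : n < d) : (of A d a * b) n = 0 := by
  induction b using DirectSum.induction_on with
  | zero => rw [mul_zero, zero_apply]
  | of i x => rw [of_mul_of, of_eq_of_ne _ _ _ (by omega)]
  | add x y hx hy => rw [mul_add, add_apply, hx, hy, add_zero]

open DirectSum in
/-- In a graded domain some prime ideal identifies a given homogeneous element of positive degree
with `1` and contains no nonzero homogeneous element. -/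
theorem DirectSum.exists_prime_of_graded_domain {A : ℕ → Type v} [∀ i, AddCommGroup (A i)]
    [GCommRing A] (hone : (GradedMonoid.GOne.one : A 0) ≠ 0)
    (hdom : ∀ {i j : ℕ} (x : A i) (y : A j), GradedMonoid.GMul.mul x y = 0 → x = 0 ∨ y = 0)
    {d : ℕ} (hd : 0 < d) (a : A d) (ha : a ≠ 0) :
    ∃ p : Ideal (⨁ i, A i), p.IsPrime ∧ of A d a - 1 ∈ p ∧
      ∀ {i : ℕ} (x : A i), x ≠ 0 → of A i x ∉ p := by
  classical
  let S : Submonoid (⨁ i, A i) :=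
    { carrier := {z | ∃ (i : ℕ) (x : A i), x ≠ 0 ∧ z = of A i x}
      one_mem' := ⟨0, GradedMonoid.GOne.one, hone, rfl⟩
      mul_mem' := by
        rintro _ _ ⟨i, x, hx, rfl⟩ ⟨j, y, hy, rfl⟩
        exact ⟨i + j, GradedMonoid.GMul.mul x y, fun h => (hdom x y h).elim hx hy, of_mul_of x y⟩ }
  obtain ⟨p, hp, hle, hdisj⟩ := Ideal.exists_le_prime_disjoint (Ideal.span {of A d a - 1}) S (by
    rw [Set.disjoint_left]
    rintro z hz ⟨s, t, ht, rfl⟩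
    obtain ⟨b, hb⟩ := Ideal.mem_span_singleton'.1 hz
    have hb : of A d a * b - b = of A s t := by rw [← hb]; ring
    -- Otherwise `(a - 1) b` is a nonzero homogeneous `t` of degree `s`. Its components `a b_{j - d}
    -- - b_j` vanish below `s`, hence so do those of `b`.
    have hlow : ∀ j, j < s → b j = 0 := by
      intro j
      induction j using Nat.strong_induction_on with
      | _ j ih =>
        intro hj
        have h1 := congrArg (fun z => z j) hb
        simp only [DirectSum.sub_apply] at h1
        rw [of_eq_of_ne _ _ _ (by omega)] at h1
        have h2 : (of A d a * b) j = 0 := by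
          by_cases hjd : j < d
          · exact of_mul_apply_of_lt a b hjd
          · obtain ⟨i, rfl⟩ := Nat.exists_eq_add_of_le (not_lt.1 hjd)
            rw [of_mul_apply_add, ih i (by omega) (by omega), GNonUnitalNonAssocSemiring.mul_zero]
        rw [h2, zero_sub, neg_eq_zero] at h1
        exact h1
    have hne : (DFinsupp.support b).Nonempty := by
      rw [Finset.nonempty_iff_ne_empty, Ne, DFinsupp.support_eq_empty]
      rintro rfl
      rw [mul_zero, sub_zero] at hb
      exact ht (of_injective s (by rw [← hb, map_zero]))
    -- The top component of `(a - 1) b` is `a b_T`, which is nonzero in degree `d + T > s`: a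
    -- contradiction.
    set T := (DFinsupp.support b).max' hne with hT
    have hTb : b T ≠ 0 := DFinsupp.mem_support_iff.1 (Finset.max'_mem _ hne)
    have hTs : s ≤ T := by
      by_contra h
      exact hTb (hlow T (not_le.1 h))
    have h1 := congrArg (fun z => z (d + T)) hb
    simp only [DirectSum.sub_apply] at h1
    have h2 : b (d + T) = 0 := by
      by_contra h
      have := Finset.le_max' _ _ (DFinsupp.mem_support_iff.2 h)
      omega
    rw [of_eq_of_ne _ _ _ (by omega), h2, sub_zero, of_mul_apply_add] at h1
    exact (hdom a _ h1).elim ha hTb)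
  exact ⟨p, hp, hle (Ideal.mem_span_singleton_self _),
    fun x hx hxp => Set.disjoint_left.1 hdisj hxp ⟨_, x, hx, rfl⟩⟩

/-! ### The operad as a graded commutative ring -/

namespace SymmOperad

variable {k : Type u} [Field k] {P : SymmOperad.{u, v} k}

/-- Injective linear maps from the spaces of an operad to an algebra that send partial compositions
to products. -/
structure MulEmbedding (P : SymmOperad.{u, v} k) (F : Type w) [CommRing F] [Algebra k F] where
  toFun : ∀ n, P.obj n →ₗ[k] F
  injective : ∀ n, Function.Injective (toFun n)
  map_one : toFun 1 P.one = 1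
  map_comp : ∀ {m n r : ℕ} (h : r + 1 = m + n) (i : Fin m) (x : P.obj m) (y : P.obj n),
    toFun r (P.comp h i x y) = toFun m x * toFun n y

/-- The spaces of an operad, graded by arity minus one. -/
abbrev shifted (P : SymmOperad.{u, v} k) (j : ℕ) : Type v := P.obj (j + 1)

/-- The result arity of a composition is a free variable, so ring axioms relating propositionally
equal degrees need no casts. -/
theorem mk_comp_congr {m n r r' : ℕ} (e : r = r') (h : r + 1 + 1 = m + n) (h' : r' + 1 + 1 = m + n)
    (i : Fin m) (x : P.obj m) (y : P.obj n) :
    (⟨r, P.comp h i x y⟩ : GradedMonoid P.shifted) = ⟨r', P.comp h' i x y⟩ := by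
  subst e
  rfl

/-- The operad as a graded monoid, with composition in the first slot as multiplication. -/
@[reducible] def gMonoid (P : SymmOperad.{u, v} k) : GradedMonoid.GMonoid P.shifted :=
  letI : GradedMonoid.GMul P.shifted :=
    ⟨fun {i j} x y => P.comp (by omega) ⟨0, Nat.succ_pos i⟩ x y⟩
  letI : GradedMonoid.GOne P.shifted := ⟨P.one⟩
  { one_mul := by
      rintro ⟨n, x⟩
      refine (mk_comp_congr (Nat.zero_add n) _
        (show n + 1 + 1 = (0 + 1) + (n + 1) by omega) _ _ _).trans ?_
      exact congrArg (Sigma.mk (β := P.shifted) n) (P.one_comp x)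
    mul_one := by
      rintro ⟨n, x⟩
      exact congrArg (Sigma.mk (β := P.shifted) n) (P.comp_one _ x)
    mul_assoc := by
      rintro ⟨i, x⟩ ⟨j, y⟩ ⟨l, z⟩
      refine Eq.trans ?_ (mk_comp_congr (Nat.add_assoc i j l)
        (show i + j + l + 1 + 1 = (i + 1) + (j + l + 1) by omega) _ _ _ _)
      exact congrArg (Sigma.mk (β := P.shifted) (i + j + l))
        (P.comp_assoc _ _ _ _ ⟨0, Nat.succ_pos i⟩ ⟨0, Nat.succ_pos j⟩ x y z) }

/-- If partial compositions commute, they make the operad a graded commutative ring. -/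
@[reducible] def gCommRing
    (hcomm : ∀ {m n r : ℕ} (h : r + 1 = m + n) (h' : r + 1 = n + m) (i : Fin m) (j : Fin n)
      (y : P.obj m) (z : P.obj n), P.comp h i y z = P.comp h' j z y) :
    DirectSum.GCommRing P.shifted where
  __ := P.gMonoid
  mul_zero _ := map_zero _
  zero_mul _ := by
    change P.comp _ _ 0 _ = 0
    rw [map_zero, LinearMap.zero_apply]
  mul_add _ _ _ := map_add _ _ _
  add_mul _ _ _ := by
    change P.comp _ _ (_ + _) _ = P.comp _ _ _ _ + P.comp _ _ _ _
    rw [map_add, LinearMap.add_apply]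
  natCast n := n • P.one
  natCast_zero := zero_smul _ _
  natCast_succ n := succ_nsmul _ _
  intCast n := n • P.one
  intCast_ofNat n := natCast_zsmul _ _
  intCast_negSucc_ofNat n := negSucc_zsmul _ _
  mul_comm := by
    rintro ⟨i, x⟩ ⟨j, y⟩
    refine Eq.trans ?_ (mk_comp_congr (Nat.add_comm i j)
      (show i + j + 1 + 1 = (j + 1) + (i + 1) by omega) _ _ _ _)
    exact congrArg (Sigma.mk (β := P.shifted) (i + j)) (hcomm _ _ _ _ x y)

theorem exists_mulEmbedding_of_domain (hred : P.IsReduced)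
    (hidx : ∀ {m n r : ℕ} (h : r + 1 = m + n) (i j : Fin m) (x : P.obj m) (y : P.obj n),
      P.comp h i x y = P.comp h j x y)
    (hcomm : ∀ {m n r : ℕ} (h : r + 1 = m + n) (h' : r + 1 = n + m) (i : Fin m) (j : Fin n)
      (y : P.obj m) (z : P.obj n), P.comp h i y z = P.comp h' j z y)
    (hdom : ∀ {m n r : ℕ} (h : r + 1 = m + n) (i : Fin m) (y : P.obj m) (z : P.obj n),
      P.comp h i y z = 0 → y = 0 ∨ z = 0)
    {d : ℕ} (hd : 0 < d) (a : P.obj (d + 1)) (ha : a ≠ 0) :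
    ∃ (K : Type v) (_ : CommRing K) (_ : IsDomain K) (_ : Algebra k K) (φ : P.MulEmbedding K),
      φ.toFun (d + 1) a = 1 := by
  let _ := gCommRing hcomm
  have hone : P.one ≠ 0 := fun h => ha (by rw [← P.one_comp a, h, map_zero, LinearMap.zero_apply])
  let _ : DirectSum.GAlgebra k P.shifted :=
    { toFun := ((LinearMap.toSpanSingleton k (P.obj 1) P.one).toAddMonoidHom : k →+ P.obj 1)
      map_one := one_smul _ _
      map_mul := fun r s => by
        refine congrArg (Sigma.mk (β := P.shifted) 0) ?_
        change (r * s) • P.one = P.comp _ _ (r • P.one) (s • P.one)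
        rw [map_smul, map_smul, LinearMap.smul_apply, P.comp_one, smul_smul, mul_comm]
      commutes := fun r x => mul_comm (G := GradedMonoid P.shifted) _ _
      smul_def := by
        rintro r ⟨n, x⟩
        refine Eq.trans ?_ (mk_comp_congr (Nat.zero_add n).symm
          (show n + 1 + 1 = (0 + 1) + (n + 1) by omega) _ _ _ _)
        refine congrArg (Sigma.mk (β := P.shifted) n) ?_
        change r • x = P.comp _ _ (r • P.one) x
        rw [map_smul, LinearMap.smul_apply]
        exact congrArg _ (P.one_comp x).symm }
  obtain ⟨p, hp, hap, hnz⟩ := DirectSum.exists_prime_of_graded_domain (A := P.shifted) hone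
    (fun x y h => hdom _ _ x y h) hd a ha
  let q : (DirectSum ℕ P.shifted) →ₐ[k] (DirectSum ℕ P.shifted ⧸ p) := Ideal.Quotient.mkₐ k p
  have hq : ∀ z, q z = Ideal.Quotient.mk p z := fun _ => rfl
  refine ⟨DirectSum ℕ P.shifted ⧸ p, inferInstance, Ideal.Quotient.isDomain p, inferInstance,
    { toFun := fun n => match n with
        | 0 => 0
        | n + 1 => q.toLinearMap ∘ₗ DirectSum.lof k ℕ P.shifted n
      injective := ?_
      map_one := ?_
      map_comp := ?_ }, ?_⟩
  · rintro (_ | n)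
    · intro x y _
      rw [hred x, hred y]
    · rw [injective_iff_map_eq_zero]
      intro x hx
      by_contra hne
      exact hnz x hne (Ideal.Quotient.eq_zero_iff_mem.1 hx)
  · exact map_one q
  · intro m n r h i x y
    obtain _ | m := m
    · exact i.elim0
    obtain _ | n := n
    · simp [hred y]
    obtain rfl : r = m + n + 1 := by omega
    refine Eq.trans ?_ (map_mul q _ _)
    refine congrArg q (Eq.trans ?_ (DirectSum.of_mul_of (A := P.shifted) x y).symm)
    exact congrArg _ (hidx h _ _ x y)
  · exact sub_eq_zero.1 ((map_sub q _ _).symm.trans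
      (Ideal.Quotient.eq_zero_iff_mem.2 hap)) |>.trans (map_one q)

end SymmOperad

/-! ### Growth, periodicity and rationality of sequences -/

/-- If the window at `D * s + c` always had sum at least `s`, adding over `t ≤ s < 2 * t` would give
quadratic partial sums, against the exponent `3 / 2`. -/
theorem exists_sum_lt_of_sq_sum_lt (f : ℕ → ℕ)
    (hf : ∃ n₀, ∀ n, n₀ ≤ n → (∑ i ∈ Finset.range (n + 1), f i) ^ 2 < n ^ 3)
    {D : ℕ} (hD : 0 < D) (c d : ℕ) : ∃ s, ∑ j ∈ Finset.range d, f (D * s + c + j) < s := by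
  by_contra! H
  obtain ⟨n₀, hn₀⟩ := hf
  -- The windows end below `n ≤ K * t`, and `t ≥ d ^ 2 * K ^ 3` gives `d ^ 2 * (K * t) ^ 3 ≤ t ^ 4`.
  set K := D * 2 + c + d with hK
  set t := d ^ 2 * K ^ 3 + n₀ + 1 with ht
  set n := D * (2 * t) + c + d with hn
  have h1 : t * t ≤ d * ∑ i ∈ Finset.range (n + 1), f i := by
    calc t * t = ∑ s ∈ Finset.Ico t (2 * t), t := by
          rw [Finset.sum_const, Nat.card_Ico, smul_eq_mul]
          congr 1
          omega
      _ ≤ ∑ s ∈ Finset.Ico t (2 * t), ∑ j ∈ Finset.range d, f (D * s + c + j) :=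
          Finset.sum_le_sum fun s hs => (Finset.mem_Ico.1 hs).1.trans (H s)
      _ = ∑ j ∈ Finset.range d, ∑ s ∈ Finset.Ico t (2 * t), f (D * s + c + j) :=
          Finset.sum_comm
      _ ≤ ∑ j ∈ Finset.range d, ∑ i ∈ Finset.range (n + 1), f i := by
          refine Finset.sum_le_sum fun j hj => ?_
          have hinj : Set.InjOn (fun s => D * s + c + j) (Finset.Ico t (2 * t) : Set ℕ) := by
            intro a _ b _ hab
            exact Nat.eq_of_mul_eq_mul_left hD (by simpa using hab)
          rw [← Finset.sum_image (f := f) hinj]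
          refine Finset.sum_le_sum_of_subset fun i hi => ?_
          obtain ⟨s, hs, rfl⟩ := Finset.mem_image.1 hi
          have h2 := (Finset.mem_Ico.1 hs).2
          have h3 := Finset.mem_range.1 hj
          have h4 : D * s ≤ D * (2 * t) := Nat.mul_le_mul_left _ h2.le
          rw [Finset.mem_range]
          omega
      _ = d * ∑ i ∈ Finset.range (n + 1), f i := by simp
  have hd : 0 < d := by
    rcases Nat.eq_zero_or_pos d with rfl | h
    · simp [ht] at h1
    · exact h
  have ht1 : 1 ≤ t := by omega
  have hnK : n ≤ K * t := by
    have h2 : c ≤ c * t := Nat.le_mul_of_pos_right _ ht1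
    have h3 : d ≤ d * t := Nat.le_mul_of_pos_right _ ht1
    rw [hn, hK, add_mul, add_mul, mul_assoc]
    omega
  have htn : n₀ ≤ n := by
    have : t ≤ D * (2 * t) := by nlinarith
    omega
  have h2 : (t * t) ^ 2 < (t * t) ^ 2 := by
    calc (t * t) ^ 2 ≤ (d * ∑ i ∈ Finset.range (n + 1), f i) ^ 2 := Nat.pow_le_pow_left h1 2
      _ = d ^ 2 * (∑ i ∈ Finset.range (n + 1), f i) ^ 2 := mul_pow _ _ _
      _ < d ^ 2 * n ^ 3 := Nat.mul_lt_mul_of_pos_left (hn₀ n htn) (by positivity)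
      _ ≤ d ^ 2 * (K * t) ^ 3 := Nat.mul_le_mul_left _ (Nat.pow_le_pow_left hnK 3)
      _ = (d ^ 2 * K ^ 3) * t ^ 3 := by ring
      _ ≤ t * t ^ 3 := Nat.mul_le_mul_right _ (by omega)
      _ = (t * t) ^ 2 := by ring
  exact lt_irrefl _ h2

theorem sum_range_shift_succ (f : ℕ → ℕ) (d n : ℕ) :
    ∑ j ∈ Finset.range d, f (n + 1 + j) + f n = ∑ j ∈ Finset.range d, f (n + j) + f (n + d) := by
  rw [← Finset.sum_range_succ (fun j => f (n + j)), Finset.sum_range_succ']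
  simp only [Nat.add_zero]
  congr 1
  exact Finset.sum_congr rfl fun j _ => congrArg f (by ring)

theorem monotone_sum_range_shift {f : ℕ → ℕ} {d : ℕ} (hf : ∀ n, f n ≤ f (n + d)) :
    Monotone fun n => ∑ j ∈ Finset.range d, f (n + j) :=
  monotone_nat_of_le_succ fun n => by
    have := sum_range_shift_succ f d n
    have := hf n
    omega

/-- The sum over `d` consecutive terms grows by `f (n + d) - f n ≥ 0` at each step; being bounded,
it attains its maximum and is constant from there on. -/
theorem eventually_periodic_of_bounded {f : ℕ → ℕ} {d : ℕ} (hf : ∀ n, f n ≤ f (n + d))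
    {B : ℕ} (hB : ∀ n, f n ≤ B) : ∃ M, ∀ n, M ≤ n → f (n + d) = f n := by
  have hbdd : BddAbove (Set.range fun n => ∑ j ∈ Finset.range d, f (n + j)) := by
    refine ⟨d * B, ?_⟩
    rintro _ ⟨n, rfl⟩
    calc ∑ j ∈ Finset.range d, f (n + j) ≤ ∑ j ∈ Finset.range d, B :=
          Finset.sum_le_sum fun j _ => hB _
      _ = d * B := by simp
  obtain ⟨M, hM⟩ := Nat.sSup_mem (Set.range_nonempty _) hbdd
  refine ⟨M, fun n hn => ?_⟩
  have h1 := monotone_sum_range_shift hf hn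
  have h2 := le_csSup hbdd ⟨n + 1, rfl⟩
  rw [← hM] at h2
  have h3 := sum_range_shift_succ f d n
  have h4 := hf n
  simp only at h1 h2
  omega

theorem bounded_of_eventually_periodic {f : ℕ → ℕ} {d : ℕ} (hd : 0 < d) {M : ℕ}
    (hM : ∀ n, M ≤ n → f (n + d) = f n) : ∃ B, ∀ n, f n ≤ B := by
  refine ⟨∑ i ∈ Finset.range (M + d), f i, fun n => ?_⟩
  induction n using Nat.strong_induction_on with
  | _ n ih =>
    by_cases hn : n < M + d
    · exact Finset.single_le_sum (f := f) (fun _ _ => Nat.zero_le _) (Finset.mem_range.2 hn)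
    · have := hM (n - d) (by omega)
      rw [Nat.sub_add_cancel (by omega)] at this
      rw [this]
      exact ih _ (by omega)

/-- Coefficients of a rational power series that repeat with period `d` on a long window
repeat forever. -/
theorem periodic_of_window {h : ℕ → ℚ} {f g : Polynomial ℚ} (hg : g ≠ 0)
    (hfg : (g : PowerSeries ℚ) * PowerSeries.mk h = (f : PowerSeries ℚ)) {M d : ℕ}
    (hM : f.natDegree < M) (hw : ∀ n, M ≤ n → n < M + g.natDegree → h (n + d) = h n) :
    ∀ n, M ≤ n → h (n + d) = h n := by
  set D := g.natDegree with hD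
  have hrec : ∀ n, M ≤ n → ∑ i ∈ Finset.range (D + 1), g.coeff i * h (n + D - i) = 0 := by
    intro n hn
    have e := congrArg (PowerSeries.coeff (n + D)) hfg
    rw [PowerSeries.coeff_mul, Polynomial.coeff_coe,
      Polynomial.coeff_eq_zero_of_natDegree_lt (by omega),
      Finset.Nat.sum_antidiagonal_eq_sum_range_succ_mk] at e
    rw [← e]
    simp only [Polynomial.coeff_coe, PowerSeries.coeff_mk]
    refine Finset.sum_subset (fun i hi => ?_) fun i _ hi => ?_
    · rw [Finset.mem_range] at hi ⊢
      omega
    · rw [Finset.mem_range] at hi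
      rw [Polynomial.coeff_eq_zero_of_natDegree_lt (by omega), zero_mul]
  intro n
  induction n using Nat.strong_induction_on with
  | _ n ih =>
    intro hn
    by_cases hlt : n < M + D
    · exact hw n hn hlt
    -- The constant coefficient of `g` may vanish, so the recurrence is solved through its lowest
    -- nonzero coefficient. Applied to `h (n + d) - h n`, all other terms vanish, by induction for
    -- `i > e`.
    set e := g.natTrailingDegree with he
    have heD : e ≤ D := Polynomial.natTrailingDegree_le_natDegree g
    have h1 := hrec (n + e - D) (by omega)
    have h2 := hrec (n + e - D + d) (by omega)
    have h3 : ∑ i ∈ Finset.range (D + 1), g.coeff i * (h (n + e - i + d) - h (n + e - i)) = 0 := by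
      rw [← sub_eq_zero.2 (h2.trans h1.symm), ← Finset.sum_sub_distrib]
      refine Finset.sum_congr rfl fun i hi => ?_
      rw [Finset.mem_range] at hi
      rw [mul_sub]
      congr 3 <;> congr 1 <;> omega
    rw [Finset.sum_eq_single e] at h3
    · have h4 : g.coeff e ≠ 0 := by
        rw [he]
        exact Polynomial.trailingCoeff_nonzero_iff_nonzero.2 hg
      have h5 := (mul_eq_zero.1 h3).resolve_left h4
      rw [Nat.add_sub_cancel] at h5
      exact sub_eq_zero.1 h5
    · intro i hi hie
      rw [Finset.mem_range] at hi
      rcases lt_or_gt_of_ne hie with hlt' | hgt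
      · rw [Polynomial.coeff_eq_zero_of_lt_natTrailingDegree hlt', zero_mul]
      · rw [ih (n + e - i) (by omega) (by omega), sub_self, mul_zero]
    · intro h
      exact absurd (Finset.mem_range.2 (by omega)) h

/-- Without a periodic window of length `L`, the sum over `d` consecutive terms would increase in
every block of length `L`, hence at least linearly, which the growth bound excludes. One window
suffices by `periodic_of_window`. -/
theorem bounded_of_rational {f : ℕ → ℕ} {d : ℕ} (hd : 0 < d) (hf : ∀ n, f n ≤ f (n + d))
    (hsum : ∃ n₀, ∀ n, n₀ ≤ n → (∑ i ∈ Finset.range (n + 1), f i) ^ 2 < n ^ 3)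
    {p g : Polynomial ℚ} (hg : g ≠ 0)
    (hpg : (g : PowerSeries ℚ) * PowerSeries.mk (fun n => (f n : ℚ)) = (p : PowerSeries ℚ)) :
    ∃ B, ∀ n, f n ≤ B := by
  set L := g.natDegree + 1 with hL
  obtain ⟨M, hM, hw⟩ : ∃ M, p.natDegree < M ∧ ∀ n, M ≤ n → n < M + L → f (n + d) = f n := by
    by_contra! H
    obtain ⟨s, hs⟩ := exists_sum_lt_of_sq_sum_lt f hsum (D := L) (by omega) (p.natDegree + 1) d
    have hmono := monotone_sum_range_shift hf
    refine absurd hs (not_lt.2 ?_)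
    clear hs
    induction s with
    | zero => exact Nat.zero_le _
    | succ s ih =>
      obtain ⟨n, hn1, hn2, hn3⟩ := H (L * s + (p.natDegree + 1)) (by omega)
      have h1 := hmono hn1
      have h2 : ∑ j ∈ Finset.range d, f (n + 1 + j) ≤
          ∑ j ∈ Finset.range d, f (L * (s + 1) + (p.natDegree + 1) + j) :=
        hmono (by rw [mul_add]; omega)
      have h3 := sum_range_shift_succ f d n
      have h4 := hf n
      simp only at h1
      omega
  refine bounded_of_eventually_periodic hd (M := M) fun n hn => ?_
  have := periodic_of_window hg hpg (d := d) hM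
    (fun n h1 h2 => by exact_mod_cast hw n h1 (by omega)) n hn
  exact_mod_cast this

theorem rational_of_eventually_periodic {f : ℕ → ℕ} {d : ℕ} (hd : 0 < d) {M : ℕ}
    (hM : ∀ n, M ≤ n → f (n + d) = f n) :
    ∃ p g : Polynomial ℚ, g ≠ 0 ∧
      (g : PowerSeries ℚ) * PowerSeries.mk (fun n => (f n : ℚ)) = (p : PowerSeries ℚ) := by
  set H : PowerSeries ℚ := PowerSeries.mk (fun n => (f n : ℚ)) with hH
  refine ⟨PowerSeries.trunc (M + d) ((PowerSeries.X ^ d - 1) * H), Polynomial.X ^ d - 1, ?_, ?_⟩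
  · simpa using Polynomial.X_pow_sub_C_ne_zero hd (1 : ℚ)
  · ext n
    rw [Polynomial.coeff_coe, PowerSeries.coeff_trunc]
    simp only [Polynomial.coe_sub, Polynomial.coe_pow, Polynomial.coe_X, Polynomial.coe_one]
    split_ifs with hn
    · rfl
    · rw [sub_mul, one_mul, map_sub, PowerSeries.coeff_X_pow_mul', if_pos (by omega), hH,
        PowerSeries.coeff_mk, PowerSeries.coeff_mk, sub_eq_zero, ← hM (n - d) (by omega),
        Nat.sub_add_cancel (by omega)]

/-! ### Consequences of GK-dimension one -/

namespace SymmOperad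

variable {k : Type u} [Field k] {P : SymmOperad.{u, v} k}

/-- The exponent `3 / 2` lies strictly between linear and quadratic growth; squaring keeps the bound
in the natural numbers. -/
theorem sq_sum_dim_lt (hgk : P.gkDim = 1) :
    ∃ n₀, ∀ n, n₀ ≤ n → (∑ i ∈ Finset.range (n + 1), P.dim i) ^ 2 < n ^ 3 := by
  have hlt : P.gkDim < ((3 / 2 : ℝ) : EReal) := by
    rw [hgk]
    exact_mod_cast (by norm_num : (1 : ℝ) < 3 / 2)
  obtain ⟨n₀, hn₀⟩ := Filter.eventually_atTop.1 (Filter.eventually_lt_of_limsup_lt hlt)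
  refine ⟨n₀ + 2, fun n hn => ?_⟩
  have h1 := EReal.coe_lt_coe_iff.1 (hn₀ n (by omega))
  set S := ∑ i ∈ Finset.range (n + 1), P.dim i
  rcases Nat.eq_zero_or_pos S with h0 | h0
  · rw [h0]
    have : 0 < n := by omega
    positivity
  · rw [Real.logb_lt_iff_lt_rpow (by exact_mod_cast (by omega : 1 < n)) (by exact_mod_cast h0)]
      at h1
    have h2 : (S : ℝ) ^ 2 < ((n : ℝ) ^ (3 / 2 : ℝ)) ^ 2 := by gcongr
    rw [← Real.rpow_natCast, ← Real.rpow_natCast, ← Real.rpow_mul (Nat.cast_nonneg n)] at h2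
    norm_num at h2
    exact_mod_cast h2

theorem isUnbounded_of_gkDim (hgk : P.gkDim = 1) : P.IsUnbounded := by
  by_contra hb
  simp only [IsUnbounded, not_forall, not_exists, not_and, not_not] at hb
  obtain ⟨N, hN⟩ := hb
  have hdim : ∀ n, N ≤ n → P.dim n = 0 := fun n hn => by
    have : Subsingleton (P.obj n) := ⟨fun x y => by rw [hN n hn x, hN n hn y]⟩
    exact Module.finrank_zero_of_subsingleton
  have hlt : ((1 / 2 : ℝ) : EReal) < P.gkDim := by
    rw [hgk]
    exact_mod_cast (by norm_num : (1 / 2 : ℝ) < 1)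
  -- The partial sums would be constantly `c` from `N` on, and `log_n c ≤ 1 / 2` once `n ≥ c ^ 2`
  -- and `n ≥ 2`.
  set c := ∑ i ∈ Finset.range (N + 1), P.dim i with hc
  obtain ⟨n, hn, hlog⟩ :=
    Filter.frequently_atTop.1 (Filter.frequently_lt_of_lt_limsup (by isBoundedDefault) hlt)
      (c ^ 2 + N + 2)
  have hS : ∑ i ∈ Finset.range (n + 1), P.dim i = c := by
    refine (Finset.sum_subset (fun i hi => ?_) fun i _ hi => ?_).symm
    · rw [Finset.mem_range] at hi ⊢
      omega
    · rw [Finset.mem_range] at hi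
      exact hdim i (by omega)
  have h1 := EReal.coe_lt_coe_iff.1 hlog
  rw [hS] at h1
  rcases Nat.eq_zero_or_pos c with h0 | h0
  · rw [h0] at h1
    norm_num at h1
  · rw [Real.lt_logb_iff_rpow_lt (by exact_mod_cast (by omega : 1 < n)) (by exact_mod_cast h0)]
      at h1
    have h2 : ((n : ℝ) ^ (1 / 2 : ℝ)) ^ 2 < (c : ℝ) ^ 2 := by gcongr
    rw [← Real.rpow_natCast, ← Real.rpow_mul (Nat.cast_nonneg n)] at h2
    norm_num at h2
    have h3 : n < c ^ 2 := by exact_mod_cast h2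
    omega

/-! ### Algebraicity, dimensions and finite generation -/

namespace MulEmbedding

/-- Composition of a multiplicative embedding with an injective algebra homomorphism. -/
def comp {F G : Type*} [CommRing F] [Algebra k F] [CommRing G] [Algebra k G]
    (φ : P.MulEmbedding F) (f : F →ₐ[k] G) (hf : Function.Injective f) : P.MulEmbedding G where
  toFun n := f.toLinearMap ∘ₗ φ.toFun n
  injective n := hf.comp (φ.injective n)
  map_one := by simp [φ.map_one]
  map_comp h i x y := by simp [φ.map_comp]

/-- A multiplicative embedding with values in an intermediate field. -/
def codRestrict {F : Type*} [Field F] [Algebra k F] (φ : P.MulEmbedding F)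
    (E : IntermediateField k F) (hE : ∀ n (x : P.obj n), φ.toFun n x ∈ E) : P.MulEmbedding E where
  toFun n :=
    { toFun := fun x => ⟨φ.toFun n x, hE n x⟩
      map_add' := fun _ _ => Subtype.ext (map_add _ _ _)
      map_smul' := fun _ _ => Subtype.ext (map_smul _ _ _) }
  injective n _ _ h := φ.injective n (congrArg Subtype.val h)
  map_one := Subtype.ext φ.map_one
  map_comp h i x y := Subtype.ext (φ.map_comp h i x y)

/-- The image of the space of operations of arity `n + 1`. -/
def image {F : Type*} [CommRing F] [Algebra k F] (φ : P.MulEmbedding F) (n : ℕ) : Submodule k F :=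
  LinearMap.range (φ.toFun (n + 1))

section image

variable {F : Type*} [CommRing F] [Algebra k F] (φ : P.MulEmbedding F)

theorem mul_mem_image {m n : ℕ} {x y : F} (hx : x ∈ φ.image m) (hy : y ∈ φ.image n) :
    x * y ∈ φ.image (m + n) := by
  obtain ⟨x, rfl⟩ := hx
  obtain ⟨y, rfl⟩ := hy
  exact ⟨P.comp (by omega) ⟨0, Nat.succ_pos m⟩ x y, φ.map_comp _ _ _ _⟩

theorem pow_mem_image {n : ℕ} {x : F} (hx : x ∈ φ.image n) (i : ℕ) :
    x ^ i ∈ φ.image (n * i) := by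
  induction i with
  | zero => exact ⟨P.one, by rw [pow_zero]; exact φ.map_one⟩
  | succ i ih =>
    rw [pow_succ]
    exact φ.mul_mem_image ih hx

theorem finrank_image (n : ℕ) : Module.finrank k (φ.image n) = P.dim (n + 1) :=
  (LinearEquiv.ofInjective _ (φ.injective (n + 1))).finrank_eq.symm

end image

/-- Since `a` has value `1`, powers of a value can be moved to a common degree by multiplying with
powers of `1`. A transcendental value would give `s + 1` independent elements in a degree linear in
`s`, for every `s`. -/
theorem isAlgebraic {F : Type*} [Field F] [Algebra k F] (φ : P.MulEmbedding F)
    (hred : P.IsReduced) (hfin : P.IsLocallyFinite)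
    (hsum : ∃ n₀, ∀ n, n₀ ≤ n → (∑ i ∈ Finset.range (n + 1), P.dim i) ^ 2 < n ^ 3)
    {d : ℕ} (hd : 0 < d) {a : P.obj (d + 1)} (ha : φ.toFun (d + 1) a = 1) {n : ℕ} (x : P.obj n) :
    IsAlgebraic k (φ.toFun n x) := by
  obtain _ | m := n
  · rw [hred x, map_zero]
    exact isAlgebraic_zero
  by_contra htr
  set u := φ.toFun (m + 1) x with hu
  have h1 : (1 : F) ∈ φ.image d := ⟨a, ha⟩
  -- Raising the degree by `d` makes it positive even when `x` is unary.
  have hmem : u ∈ φ.image (d + m) := by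
    rw [← one_mul u]
    exact φ.mul_mem_image h1 ⟨x, rfl⟩
  -- The power `u ^ d` is used because its degree `(d + m) * d` is a multiple of `d`, so the missing
  -- degree is filled by `1 ^ ((d + m) * (s - i))`.
  have hpow : ∀ s i, i ≤ s → (u ^ d) ^ i ∈ φ.image ((d + m) * d * s) := by
    intro s i hi
    have h2 := φ.mul_mem_image (φ.pow_mem_image (φ.pow_mem_image hmem d) i)
      (φ.pow_mem_image h1 ((d + m) * (s - i)))
    rw [one_pow, mul_one] at h2
    convert h2 using 2
    obtain ⟨j, rfl⟩ := Nat.exists_eq_add_of_le hi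
    rw [Nat.add_sub_cancel_left]
    ring
  obtain ⟨s, hs⟩ := exists_sum_lt_of_sq_sum_lt P.dim hsum (D := (d + m) * d)
    (Nat.mul_pos (by omega) hd) 1 1
  rw [Finset.sum_range_one, Nat.add_zero, ← φ.finrank_image] at hs
  have hli : LinearIndependent k fun i : Fin (s + 1) => (u ^ d) ^ (i : ℕ) := by
    have h2 : Transcendental k (u ^ d) := Transcendental.pow htr hd
    have h3 := (Polynomial.basisMonomials k).linearIndependent.map'
      (Polynomial.aeval (u ^ d)).toLinearMap
      (LinearMap.ker_eq_bot.2 (transcendental_iff_injective.1 h2))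
    have h4 := h3.comp _ (Fin.val_injective (n := s + 1))
    simpa [Function.comp_def] using h4
  have hli' : LinearIndependent k fun i : Fin (s + 1) =>
      (⟨(u ^ d) ^ (i : ℕ), hpow s i (Nat.lt_succ_iff.1 i.2)⟩ : φ.image ((d + m) * d * s)) :=
    LinearIndependent.of_comp (φ.image ((d + m) * d * s)).subtype hli
  have := hfin ((d + m) * d * s + 1)
  have : FiniteDimensional k (φ.image ((d + m) * d * s)) := by
    unfold image
    infer_instance
  have := hli'.fintype_card_le_finrank
  rw [Fintype.card_fin] at this
  omega

theorem isSuboperadOf_com {F : Type w} [Field F] [Algebra k F] (φ : P.MulEmbedding F)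
    (hred : P.IsReduced) (H : P.IsTrivialAction) : P.IsSuboperadOf (Com k F) := by
  refine ⟨⟨fun n => LinearMap.codRestrict (supported k F (1 ≤ n)) (φ.toFun n) fun x hn => ?_,
    Subtype.ext φ.map_one, fun σ x => ?_, fun h i x y => Subtype.ext (φ.map_comp h i x y)⟩,
    fun n x y h => φ.injective n (congrArg Subtype.val h)⟩
  · obtain rfl : n = 0 := by omega
    rw [hred x, map_zero]
  · rw [H σ x]
    rfl

theorem isSuboperadOf_ope {F : Type w} [Field F] [Algebra k F] (φ : P.MulEmbedding F)
    (H : P.IsOddSignAction) : P.IsSuboperadOf (Ope k F) := by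
  obtain ⟨H1, H2⟩ := H
  refine ⟨⟨fun n => LinearMap.codRestrict (supported k F (Odd n)) (φ.toFun n) fun x hn => ?_,
    Subtype.ext φ.map_one, fun σ x => ?_, fun h i x y => Subtype.ext (φ.map_comp h i x y)⟩,
    fun n x y h => φ.injective n (congrArg Subtype.val h)⟩
  · rw [H2 (Nat.not_odd_iff_even.1 hn) x, map_zero]
  · refine Subtype.ext ((congrArg (φ.toFun _) (H1 σ x)).trans ?_)
    rw [map_smul]
    rfl

theorem isSuboperadOf {F : Type w} [Field F] [Algebra k F] (φ : P.MulEmbedding F)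
    (hred : P.IsReduced) (H : P.IsTrivialAction ∨ P.IsOddSignAction) :
    P.IsSuboperadOf (Com k F) ∨ P.IsSuboperadOf (Ope k F) :=
  H.imp (φ.isSuboperadOf_com hred) φ.isSuboperadOf_ope

theorem comp_injective {F : Type w} [Field F] [Algebra k F] (φ : P.MulEmbedding F) {d n : ℕ}
    {a : P.obj (d + 1)} (ha : a ≠ 0) (h : n + d + 1 = (d + 1) + n) :
    Function.Injective (P.comp h ⟨0, Nat.succ_pos d⟩ a) := by
  rw [injective_iff_map_eq_zero]
  intro x hx
  have h1 := φ.map_comp h ⟨0, Nat.succ_pos d⟩ a x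
  rw [hx, map_zero] at h1
  refine (map_eq_zero_iff _ (φ.injective n)).1 ((mul_eq_zero.1 h1.symm).resolve_left fun h2 => ?_)
  exact ha ((map_eq_zero_iff _ (φ.injective _)).1 h2)

/-- The dimensions are nondecreasing in steps of `d` if there is a nonzero operation of arity
`d + 1`. -/
theorem dim_le_dim_add {F : Type w} [Field F] [Algebra k F] (φ : P.MulEmbedding F)
    (hfin : P.IsLocallyFinite) {d : ℕ} {a : P.obj (d + 1)} (ha : a ≠ 0) (n : ℕ) :
    P.dim n ≤ P.dim (n + d) := by
  have := hfin n
  have := hfin (n + d)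
  exact LinearMap.finrank_le_finrank_of_injective
    (φ.comp_injective ha (by omega : n + d + 1 = (d + 1) + n))

/-- Composition with `a` is injective, hence bijective between arities of equal dimension. From `M`
on, everything is a composition of `a` with an operation of lower arity. -/
theorem isFinitelyGenerated {F : Type w} [Field F] [Algebra k F] (φ : P.MulEmbedding F)
    (hfin : P.IsLocallyFinite) {d : ℕ} (hd : 0 < d) {a : P.obj (d + 1)} (ha : a ≠ 0) {M : ℕ}
    (hM : ∀ n, M ≤ n → P.dim (n + d) = P.dim n) : P.IsFinitelyGenerated := by
  have hgen : ∀ n, ∃ s : Set (P.obj n), s.Finite ∧ Submodule.span k s = ⊤ := fun n =>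
    Submodule.fg_def.1 (hfin n).fg_top
  choose s hs hspan using hgen
  refine ⟨⋃ n ∈ Finset.range (M + d + 2), Sigma.mk n '' s n,
    Set.Finite.biUnion (Finset.finite_toSet _) fun n _ => (hs n).image _, fun Q hQ => ?_⟩
  have hlow : ∀ n, n < M + d + 2 → Q.carrier n = ⊤ := by
    intro n hn
    rw [eq_top_iff, ← hspan n, Submodule.span_le]
    intro x hx
    exact hQ ⟨n, x⟩ (Set.mem_biUnion (Finset.mem_coe.2 (Finset.mem_range.2 hn)) ⟨x, hx, rfl⟩)
  intro n
  induction n using Nat.strong_induction_on with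
  | _ n ih =>
    by_cases hn : n < M + d + 2
    · exact hlow n hn
    obtain ⟨m, rfl⟩ := Nat.exists_eq_add_of_le' (by omega : d ≤ n)
    rw [eq_top_iff]
    intro x _
    have := hfin m
    have := hfin (m + d)
    have h : m + d + 1 = (d + 1) + m := by omega
    obtain ⟨y, rfl⟩ := (LinearMap.injective_iff_surjective_of_finrank_eq_finrank
      (f := P.comp h ⟨0, Nat.succ_pos d⟩ a) (hM m (by omega)).symm).1 (φ.comp_injective ha h) x
    refine Q.comp_mem h _ ?_ ?_
    · rw [hlow (d + 1) (by omega)]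
      trivial
    · rw [ih m (by omega)]
      trivial

/-- The operations with values in the field generated by the values of the generators form a
suboperad, so they are all the operations. -/
theorem exists_finite_of_isFinitelyGenerated {F : Type w} [Field F] [Algebra k F]
    [Algebra.IsAlgebraic k F] (φ : P.MulEmbedding F) (H : P.IsSignedAction)
    (hP : P.IsFinitelyGenerated) :
    ∃ E : IntermediateField k F, FiniteDimensional k E ∧ Nonempty (P.MulEmbedding E) := by
  obtain ⟨S, hS, hgen⟩ := hP
  set T : Set F := (fun s : Σ n, P.obj n => φ.toFun s.1 s.2) '' S
  have hT : Finite T := hS.image _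
  refine ⟨IntermediateField.adjoin k T, IntermediateField.finiteDimensional_adjoin
    fun x _ => Algebra.IsIntegral.isIntegral x, ⟨φ.codRestrict _ fun n x => ?_⟩⟩
  set E := IntermediateField.adjoin k T
  let Q : Suboperad P :=
    { carrier := fun n => (Subalgebra.toSubmodule E.toSubalgebra).comap (φ.toFun n)
      one_mem := by
        change φ.toFun 1 P.one ∈ E
        rw [φ.map_one]
        exact one_mem E
      act_mem := fun {n} σ x hx => by
        change φ.toFun n _ ∈ E
        have hx : φ.toFun n x ∈ E := hx
        rcases H σ x with h | h
        · rwa [h]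
        · rw [h, map_neg]
          exact neg_mem hx
      comp_mem := fun {m n r} h i x y hx hy => by
        change φ.toFun r _ ∈ E
        rw [φ.map_comp]
        exact mul_mem (show φ.toFun m x ∈ E from hx) hy }
  have hx : x ∈ Q.carrier n := by
    rw [hgen Q (fun s hs => IntermediateField.subset_adjoin k T ⟨s, hs, rfl⟩) n]
    trivial
  exact hx

end MulEmbedding

theorem IsSuboperadOf.mulEmbedding_of_com {F : Type w} [Field F] [Algebra k F]
    (h : P.IsSuboperadOf (Com k F)) : Nonempty (P.MulEmbedding F) := by
  obtain ⟨f, hf⟩ := h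
  exact ⟨{
    toFun := fun n => (supported k F (1 ≤ n)).subtype ∘ₗ f.toFun n
    injective := fun n => Subtype.val_injective.comp (hf n)
    map_one := congrArg Subtype.val f.map_one
    map_comp := fun h i x y => congrArg Subtype.val (f.map_comp h i x y) }⟩

theorem IsSuboperadOf.mulEmbedding_of_ope {F : Type w} [Field F] [Algebra k F]
    (h : P.IsSuboperadOf (Ope k F)) : Nonempty (P.MulEmbedding F) := by
  obtain ⟨f, hf⟩ := h
  exact ⟨{
    toFun := fun n => (supported k F (Odd n)).subtype ∘ₗ f.toFun n
    injective := fun n => Subtype.val_injective.comp (hf n)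
    map_one := congrArg Subtype.val f.map_one
    map_comp := fun h i x y => congrArg Subtype.val (f.map_comp h i x y) }⟩

theorem MulEmbedding.dim_le_finrank {F : Type w} [Field F] [Algebra k F] [FiniteDimensional k F]
    (φ : P.MulEmbedding F) (n : ℕ) : P.dim n ≤ Module.finrank k F :=
  LinearMap.finrank_le_finrank_of_injective (φ.injective n)

theorem IsPrime.exists_mulEmbedding (hP : P.IsPrime) (hred : P.IsReduced)
    (hfin : P.IsLocallyFinite) (H : P.IsTrivialAction ∨ P.IsOddSignAction) (hgk : P.gkDim = 1)
    {d : ℕ} (hd : 0 < d) {a : P.obj (d + 1)} (ha : a ≠ 0) :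
    Nonempty (P.MulEmbedding (AlgebraicClosure k)) := by
  have hinf := isUnbounded_of_gkDim hgk
  obtain ⟨K, _, _, _, φ, hφ⟩ := exists_mulEmbedding_of_domain hred (comp_index H)
    (hP.comp_comm hred hinf H) (hP.eq_zero_or_eq_zero hred hinf (isSignedAction_of_or H)) hd a ha
  let ψ : P.MulEmbedding (FractionRing K) :=
    φ.comp (IsScalarTower.toAlgHom k K (FractionRing K)) (IsFractionRing.injective K _)
  have hψ : ψ.toFun (d + 1) a = 1 := by
    change algebraMap K (FractionRing K) (φ.toFun (d + 1) a) = 1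
    rw [hφ, map_one]
  -- The fraction field may itself be transcendental over `k`; only the values need to be algebraic.
  let χ := ψ.codRestrict (algebraicClosure k (FractionRing K)) fun n x =>
    mem_algebraicClosure_iff.2 (ψ.isAlgebraic hred hfin (sq_sum_dim_lt hgk) hd hψ x)
  let f : algebraicClosure k (FractionRing K) →ₐ[k] AlgebraicClosure k := IsAlgClosed.lift
  exact ⟨χ.comp f f.toRingHom.injective⟩

end SymmOperad

/-! ### The main theorem -/

theorem theorem5p1 {k : Type u} [Field k] (P : SymmOperad.{u, v} k)
    (hred : P.IsReduced) (hfin : P.IsLocallyFinite) (hprime : P.IsPrime)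
    (hatr : P.IsAlmostATrivial) (hgk : P.gkDim = 1) :
    (P.IsSuboperadOf (SymmOperad.Com k (AlgebraicClosure k)) ∨
      P.IsSuboperadOf (SymmOperad.Ope k (AlgebraicClosure k))) ∧
    List.TFAE [
      P.IsFinitelyGenerated,
      ∃ (F : Type u) (_ : Field F) (_ : Algebra k F), FiniteDimensional k F ∧
        (P.IsSuboperadOf (SymmOperad.Com k F) ∨ P.IsSuboperadOf (SymmOperad.Ope k F)),
      P.IsUniformlyBounded,
      P.HasRationalHilbertSeries] ∧
    (IsAlgClosed k → P.IsFinitelyGenerated ∧ P.IsConnected) := by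
  have hinf := SymmOperad.isUnbounded_of_gkDim hgk
  have H := hprime.isTrivialAction_or_isOddSignAction hred hinf hatr
  obtain ⟨d, hd, a, ha⟩ : ∃ d, 0 < d ∧ ∃ a : P.obj (d + 1), a ≠ 0 := by
    obtain ⟨n, hn, a, ha⟩ := hinf 2
    obtain ⟨d, rfl⟩ := Nat.exists_eq_add_of_le' (by omega : 1 ≤ n)
    exact ⟨d, by omega, a, ha⟩
  obtain ⟨φ⟩ := hprime.exists_mulEmbedding hred hfin H hgk hd ha
  have hmono := φ.dim_le_dim_add hfin ha
  have hbg : P.IsUniformlyBounded → P.IsFinitelyGenerated := by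
    rintro ⟨B, hB⟩
    obtain ⟨M, hM⟩ := eventually_periodic_of_bounded hmono hB
    exact φ.isFinitelyGenerated hfin hd ha hM
  refine ⟨φ.isSuboperadOf hred H, ?_, fun hk => ?_⟩
  · tfae_have 1 → 2 := fun h => by
      obtain ⟨E, hE, ⟨ψ⟩⟩ :=
        φ.exists_finite_of_isFinitelyGenerated (SymmOperad.isSignedAction_of_or H) h
      exact ⟨E, inferInstance, inferInstance, hE, ψ.isSuboperadOf hred H⟩
    tfae_have 2 → 3 := by
      rintro ⟨F, _, _, _, h⟩
      obtain ⟨ψ⟩ := h.elim (·.mulEmbedding_of_com) (·.mulEmbedding_of_ope)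
      exact ⟨_, ψ.dim_le_finrank⟩
    tfae_have 3 → 1 := hbg
    tfae_have 3 → 4 := by
      rintro ⟨B, hB⟩
      obtain ⟨M, hM⟩ := eventually_periodic_of_bounded hmono hB
      exact rational_of_eventually_periodic hd hM
    tfae_have 4 → 3 := by
      rintro ⟨p, g, hg, hpg⟩
      exact bounded_of_rational hd hmono (SymmOperad.sq_sum_dim_lt hgk) hg hpg
    tfae_finish
  -- Over an algebraically closed field the values can be taken in `k` itself, so all dimensions are
  -- at most one, and the identity operation is nonzero.
  · let e : AlgebraicClosure k →ₐ[k] k := IsAlgClosed.lift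
    have hle : ∀ n, P.dim n ≤ 1 := fun n =>
      ((φ.comp e e.toRingHom.injective).dim_le_finrank n).trans (Module.finrank_self k).le
    refine ⟨hbg ⟨1, hle⟩, le_antisymm (hle 1) ?_⟩
    have := hfin 1
    refine Module.finrank_pos_iff_exists_ne_zero.2 ⟨P.one, fun h => ?_⟩
    exact ha (by rw [← P.one_comp a, h, map_zero, LinearMap.zero_apply])
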